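/- **Theorem 2 (Single-sample classification error).** *Setting.* Let $K\ge 1$ agents have feature spaces $\mathcal H_k$ and likelihood models $L_k(\cdot|\gamma)$ (probability laws on $\mathcal H_k$), $\gamma\in\{+1,-1\}$. The combination matrix $A=[a_{\ell k}]$ has nonnegative entries and columns summing to $1$. Its graph is strongly connected (any two distinct agents are joined in both directions by paths of positive weights) and $a_{mm}>0$ for some $m$. Let $\pi$ be its Perron eigenvector: $A\pi=\pi$, $\sum_k\pi_k=1$, $\pi_k>0$. The loss $\phi:\mathbb R\to[0,\infty)$ is convex, non-increasing, $L_\phi$-Lipschitz, and differentiable at $0$ with $\phi'(0)<0$. Each $\mathcal F_k$ is a class of real functions on $\mathcal H_k$ with $|f|\le\beta$ for all $f\in\mathcal F_k$, where $\beta>0$. The members of $\mathcal F_k$ are measurable, and so are suprema over $\mathcal F_k$ of continuous functions of finitely many evaluations. *Training.* Agent $k$ has $N_k\ge1$ i.i.d. training pairs $(\tilde h_{k,n},\tilde\gamma_{k,n})$, where $\tilde\gamma_{k,n}$ is uniform on $\{\pm1\}$ and $\tilde h_{k,n}$ has law $L_k(\cdot|\gamma)$ given $\tilde\gamma_{k,n}=\gamma$.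 A (measurable) training rule returns a minimizer $\tilde f_k\in\mathcal F_k$ of the empirical risk $\frac1{N_k}\sum_n\phi(\tilde\gamma_{k,n}f_k(\tilde h_{k,n}))$. Put $\tilde\mu_k(f_k)=\frac1{N_k}\sum_n f_k(\tilde h_{k,n})$ and $\tilde c_k(h)=\tilde f_k(h)-\tilde\mu_k(\tilde f_k)$. Let $\mu^{\pm}(\tilde f)=\sum_k\pi_k\mathbb E_{h\sim L_k(\cdot|\pm1)}\tilde f_k(h)$ and $\tilde\mu(\tilde f)=\sum_k\pi_k\tilde\mu_k(\tilde f_k)$. The event of $\delta$-margin consistent training is $$\mathcal C_\delta=\{\mu^+(\tilde f)>\tilde\mu(\tilde f)+\delta,\ \mu^-(\tilde f)<\tilde\mu(\tilde f)-\delta\}.$$ *Prediction.* A label $\gamma_s\in\{\pm1\}$ (with any prior) and test samples $h_{k,s}$ are independent of the training phase. Given $\gamma_s$, the $h_{k,s}$ are mutually independent with $h_{k,s}\sim L_k(\cdot|\gamma_s)$. The agents run $\lambda_{k,1}=\tilde c_k(h_{k,s})$, $\lambda_{k,t}=\sum_\ell a_{\ell k}\lambda_{\ell,t-1}$, and decide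 by the sign of the limit. The event of misclassification is $\mathcal M_s=\{\gamma_s\tilde c_s\le0\}$ with $\tilde c_s=\sum_k\pi_k\tilde c_k(h_{k,s})$, and $P_e=\mathbb P(\mathcal M_s)$. *Constants.* - $N_{\max}=\max_kN_k$ and $\alpha=\sum_k\pi_kN_{\max}/N_k$. - $\mathsf R^o=\sum_k\pi_k\inf_{f_k\in\mathcal F_k}\mathbb E\,\phi(\tilde\gamma_{k,n}f_k(\tilde h_{k,n}))$. - $\rho=\sum_k\pi_k\,\mathbb E\sup_{f_k\in\mathcal F_k}\bigl|\frac1{N_k}\sum_n r_nf_k(\tilde h_{k,n})\bigr|$ with i.i.d. uniform signs $r_n$, independent of the data. - $g(d)=d-\frac{\phi(d)-\mathsf R^o}{2L_\phi}$. The number $d_\delta^\star$ is the unique solution of $g(d)=\delta$, and $\mathcal E(\mathsf R^o,\delta)=\frac{d^\star_\delta-\delta}4$. - $d_{\mathsf R}=\inf\{x:\phi(x)=\mathsf R^o\}$ and $\delta_{\max}=\sup\{\delta\ge0: g(d)=\delta\text{ has a solution }d<d_{\mathsf R}\}$. *Claim.* Assume $\mathsf R^o<\phi(0)$, $0\le\delta<\delta_{\max}$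 and $\rho<\mathcal E(\mathsf R^o,\delta)$. Then $\lim_{t\to\infty}\lambda_{k,t}=\tilde c_s$ for every agent $k$, $$\mathbb P(\mathcal M_s\mid\mathcal C_\delta)\le\exp\Bigl\{-\frac{\delta^2}{2\beta^2\sum_k\pi_k^2}\Bigr\}$$ (a statement about conditional probability, so only of content when $\mathbb P(\mathcal C_\delta)>0$), and $$P_e\le 2\exp\Bigl\{-\frac{8N_{\max}}{\alpha^2\beta^2}\bigl(\mathcal E(\mathsf R^o,\delta)-\rho\bigr)^2\Bigr\}+\exp\Bigl\{-\frac{\delta^2}{2\beta^2\sum_k\pi_k^2}\Bigr\}.$$ -/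

import Mathlib

open MeasureTheory ProbabilityTheory Filter Topology
open scoped ENNReal NNReal

namespace SocialLearning

/-- Labels are Booleans; `true` stands for the class `+1` and `false` for the class `-1`. -/
def sgn (b : Bool) : ℝ := if b then 1 else -1

/-! ### Assumptions on the loss, the combination policy and the function classes -/

/-- The loss function is nonnegative, convex, non-increasing, differentiable at `0` with negative
derivative there, and Lipschitz with constant `Lφ`. -/
structure IsAdmissibleLoss (φ : ℝ → ℝ) (Lφ : ℝ≥0) : Prop where
  nonneg : ∀ x, 0 ≤ φ x
  convex : ConvexOn ℝ Set.univ φ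
  antitone : Antitone φ
  differentiableAt : DifferentiableAt ℝ φ 0
  deriv_neg : deriv φ 0 < 0
  lipschitz : LipschitzWith Lφ φ

/-- `A ℓ k` is the weight that agent `k` assigns to agent `ℓ` (it is positive exactly when `ℓ` is a
neighbour of `k`).  The columns sum to one, any two distinct agents are joined by a path of positive
weights in both directions, and some agent has a self-loop. -/
structure IsStronglyConnectedPolicy {ι : Type*} [Fintype ι] (A : Matrix ι ι ℝ) : Prop where
  nonneg : ∀ ℓ k, 0 ≤ A ℓ k
  sum_col : ∀ k, ∑ ℓ, A ℓ k = 1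
  connected : ∀ ℓ k, ℓ ≠ k → Relation.TransGen (fun i j => 0 < A i j) ℓ k
  self_loop : ∃ m, 0 < A m m

/-- `π` is the Perron eigenvector of `A`, normalized to have positive entries with sum one. -/
structure IsPerronVector {ι : Type*} [Fintype ι] (A : Matrix ι ι ℝ) (π : ι → ℝ) : Prop where
  eigen : A.mulVec π = π
  sum_eq_one : ∑ k, π k = 1
  pos : ∀ k, 0 < π k

/-- The usual measurability requirement on a function class: its members are measurable, and so are
the suprema over the class of continuous functions of finitely many evaluations. (This holds for
countable classes and for classes which contain a countable pointwise dense subclass.) -/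
def IsMeasurableClass {H : Type*} [MeasurableSpace H] (F : Set (H → ℝ)) : Prop :=
  (∀ f ∈ F, Measurable f) ∧
    ∀ (n : ℕ) (g : (Fin n → ℝ) → ℝ), Continuous g →
      Measurable fun h : Fin n → H => ⨆ f : F, g fun i => (f : H → ℝ) (h i)

/-! ### Quantities of a single agent -/

section Agent

variable {H : Type*} [MeasurableSpace H]

/-- Law of a training pair: the label is uniform, and given the label `γ` the feature vector has the
law `L γ`. -/
noncomputable def trainLaw (L : Bool → Measure H) : Measure (H × Bool) :=
  (2 : ℝ≥0∞)⁻¹ • ((L true).map (fun h => (h, true)) + (L false).map (fun h => (h, false)))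

/-- Empirical risk of `f` on a training set. -/
noncomputable def empRisk (φ : ℝ → ℝ) {n : ℕ} (z : Fin n → H × Bool) (f : H → ℝ) : ℝ :=
  (n : ℝ)⁻¹ * ∑ i, φ (sgn (z i).2 * f (z i).1)

/-- Expected risk of `f`. -/
noncomputable def risk (φ : ℝ → ℝ) (L : Bool → Measure H) (f : H → ℝ) : ℝ :=
  ∫ z, φ (sgn z.2 * f z.1) ∂(trainLaw L)

/-- Target risk: the infimum of the expected risk over the function class. -/
noncomputable def targetRisk (φ : ℝ → ℝ) (L : Bool → Measure H) (F : Set (H → ℝ)) : ℝ :=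
  ⨅ f : F, risk φ L f

/-- Empirical training mean of `f`. -/
noncomputable def empMean {n : ℕ} (z : Fin n → H × Bool) (f : H → ℝ) : ℝ :=
  (n : ℝ)⁻¹ * ∑ i, f (z i).1

/-- Empirical Rademacher complexity; the expectation over the i.i.d. uniform signs is the average
over all sign patterns. -/
noncomputable def empRademacher (F : Set (H → ℝ)) {n : ℕ} (h : Fin n → H) : ℝ :=
  ((2 : ℝ) ^ n)⁻¹ * ∑ r : Fin n → Bool,
    ⨆ f : F, |(n : ℝ)⁻¹ * ∑ i, sgn (r i) * (f : H → ℝ) (h i)|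

/-- Expected Rademacher complexity for `n` i.i.d. training samples. -/
noncomputable def rademacher (L : Bool → Measure H) (F : Set (H → ℝ)) (n : ℕ) : ℝ :=
  ∫ z, empRademacher F (fun i => (z i).1) ∂(Measure.pi fun _ : Fin n => trainLaw L)

/-- The learned decision statistic `f̃ - μ̃(f̃)`, where `f̃ = T z` is the function that the training
rule `T` returns on the training set `z`. -/
noncomputable def statistic {n : ℕ} (T : (Fin n → H × Bool) → H → ℝ)
    (z : Fin n → H × Bool) (h : H) : ℝ :=
  T z h - empMean z (T z)

/-- The training rule `T` returns an empirical risk minimizer in `F` on the training set `z`. -/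
def MinimizesEmpRisk (φ : ℝ → ℝ) (F : Set (H → ℝ)) {n : ℕ}
    (T : (Fin n → H × Bool) → H → ℝ) (z : Fin n → H × Bool) : Prop :=
  T z ∈ F ∧ ∀ f ∈ F, empRisk φ z (T z) ≤ empRisk φ z f

end Agent

/-! ### Critical margin and task difficulty -/

/-- `g(d) = d - (φ(d) - R) / (2 Lφ)`. -/
noncomputable def gapFn (φ : ℝ → ℝ) (Lφ : ℝ≥0) (R d : ℝ) : ℝ := d - (φ d - R) / (2 * Lφ)

/-- The solution `d⋆` of `g(d) = δ` (for an admissible loss there is exactly one, so the set below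
is a singleton). -/
noncomputable def dStar (φ : ℝ → ℝ) (Lφ : ℝ≥0) (R δ : ℝ) : ℝ := sInf {d | gapFn φ Lφ R d = δ}

/-- `𝓔(R, δ) = (d⋆ - δ) / 4`. -/
noncomputable def difficulty (φ : ℝ → ℝ) (Lφ : ℝ≥0) (R δ : ℝ) : ℝ := (dStar φ Lφ R δ - δ) / 4

/-- `d_R = inf {x | φ(x) = R}`. -/
noncomputable def dTarget (φ : ℝ → ℝ) (R : ℝ) : ℝ := sInf {x | φ x = R}

/-- `δ_max = sup {δ ≥ 0 | g(d) = δ has a solution d < d_R}`. -/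
noncomputable def deltaMax (φ : ℝ → ℝ) (Lφ : ℝ≥0) (R : ℝ) : ℝ :=
  sSup {δ | 0 ≤ δ ∧ ∃ d, gapFn φ Lφ R d = δ ∧ d < dTarget φ R}

/-! ### Network quantities -/

section Network

variable {ι : Type*} [Fintype ι]

/-- Largest training set size in the network. -/
def Nmax (N : ι → ℕ) : ℕ := Finset.univ.sup N

/-- Network imbalance penalty `α`. -/
noncomputable def imbalance (π : ι → ℝ) (N : ι → ℕ) : ℝ := ∑ k, π k * ((Nmax N : ℝ) / (N k : ℝ))

/-- The local consensus rule started from the local statistics `x`: in every communication round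
each agent replaces its value by the weighted combination of its neighbours' values. -/
noncomputable def consensus (A : Matrix ι ι ℝ) (x : ι → ℝ) : ℕ → ι → ℝ
  | 0 => x
  | t + 1 => fun k => ∑ ℓ, A ℓ k * consensus A x t ℓ

variable {H : ι → Type*} [∀ k, MeasurableSpace (H k)]

/-- Network target risk. -/
noncomputable def netTargetRisk (π : ι → ℝ) (φ : ℝ → ℝ) (L : ∀ k, Bool → Measure (H k))
    (F : ∀ k, Set (H k → ℝ)) : ℝ :=
  ∑ k, π k * targetRisk φ (L k) (F k)

/-- Expected network Rademacher complexity `ρ`. -/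
noncomputable def netRademacher (π : ι → ℝ) (L : ∀ k, Bool → Measure (H k))
    (F : ∀ k, Set (H k → ℝ)) (N : ι → ℕ) : ℝ :=
  ∑ k, π k * rademacher (L k) (F k) (N k)

/-- Network average of the conditional means of the functions `f k` given the label `γ`. -/
noncomputable def netMean (π : ι → ℝ) (L : ∀ k, Bool → Measure (H k)) (γ : Bool)
    (f : ∀ k, H k → ℝ) : ℝ :=
  ∑ k, π k * ∫ h, f k h ∂(L k γ)

/-- Network average of the empirical training means of the functions `f k`. -/
noncomputable def netEmpMean (π : ι → ℝ) {N : ι → ℕ} (z : ∀ k, Fin (N k) → H k × Bool)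
    (f : ∀ k, H k → ℝ) : ℝ :=
  ∑ k, π k * empMean (z k) (f k)

/-- The `δ`-margin consistent training condition for the training sets `z`. -/
def MarginConsistent (π : ι → ℝ) (L : ∀ k, Bool → Measure (H k)) (δ : ℝ) {N : ι → ℕ}
    (T : ∀ k, (Fin (N k) → H k × Bool) → H k → ℝ) (z : ∀ k, Fin (N k) → H k × Bool) : Prop :=
  netMean π L true (fun k => T k (z k)) > netEmpMean π z (fun k => T k (z k)) + δ ∧
    netMean π L false (fun k => T k (z k)) < netEmpMean π z (fun k => T k (z k)) - δ

/-- The ensemble classifier `∑ k, π k * c̃ k (h k)`. -/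
noncomputable def ensemble (π : ι → ℝ) {N : ι → ℕ}
    (T : ∀ k, (Fin (N k) → H k × Bool) → H k → ℝ) (z : ∀ k, Fin (N k) → H k × Bool)
    (h : ∀ k, H k) : ℝ :=
  ∑ k, π k * statistic (T k) (z k) (h k)

end Network

end SocialLearning

open SocialLearning

/-! ### Convergence of the consensus rule -/

section Consensus

variable {ι : Type*} [Fintype ι] {A : Matrix ι ι ℝ} {π : ι → ℝ}

/-! Consensus: a path through the self-loop makes some power of `A` entrywise positive, and that
power contracts the sup norm on vectors of zero `π`-average, while the `π`-average itself is
conserved. Error bound: split misclassification according to whether training was margin consistent.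
Given a margin consistent training set, the signed ensemble statistic has mean at least `δ`, and
Hoeffding's inequality over the independent test samples applies (`measure_misclassified_inter_le`).
For the training phase, let `m⁺`, `m⁻` be the network means and `m` the empirical mean. Margin
consistency follows once the half-width `(m⁺ - m⁻) / 2` exceeds `d⋆` and the centre `(m⁺ + m⁻) / 2`
is within `d⋆ - δ` of `m`. Jensen bounds the loss of the half-width by the network risk, so the
first condition holds if the excess risk is below `φ(d⋆) - R = 8 Lφ 𝓔`; the second is a uniform
deviation below `4 𝓔` (`marginConsistent_of_lt`). Both quantities are controlled by suprema over the
classes: symmetrization and contraction bound their means by `2 Lφ ρ` and `2 ρ`, and bounded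
differences make them sub-Gaussian. Agents may be dependent during training, so the sub-Gaussian
scales add linearly over the network, which produces `α`. The equation for `d⋆` balances the
thresholds so that both exponents are at least `8 (𝓔 - ρ)²`, up to the common factor. -/

lemma Matrix.pow_entry_nonneg [DecidableEq ι] (hA : ∀ i j, 0 ≤ A i j) (n : ℕ) (i j : ι) :
    0 ≤ (A ^ n) i j := by
  induction n generalizing i j with
  | zero =>
    rw [pow_zero, Matrix.one_apply]
    split_ifs <;> norm_num
  | succ n ih =>
    rw [pow_succ, Matrix.mul_apply]
    exact Finset.sum_nonneg fun k _ => mul_nonneg (ih i k) (hA k j)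

lemma Matrix.pow_add_entry_pos [DecidableEq ι] (hA : ∀ i j, 0 ≤ A i j) {a b : ℕ} {i k j : ι}
    (h₁ : 0 < (A ^ a) i k) (h₂ : 0 < (A ^ b) k j) : 0 < (A ^ (a + b)) i j := by
  rw [pow_add, Matrix.mul_apply]
  exact Finset.sum_pos' (fun l _ => mul_nonneg (Matrix.pow_entry_nonneg hA a i l)
    (Matrix.pow_entry_nonneg hA b l j)) ⟨k, Finset.mem_univ k, mul_pos h₁ h₂⟩

lemma Matrix.exists_pow_entry_pos_of_transGen [DecidableEq ι] (hA : ∀ i j, 0 ≤ A i j) {i j : ι}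
    (h : Relation.TransGen (fun i j => 0 < A i j) i j) : ∃ n, 0 < (A ^ n) i j := by
  induction h with
  | single h => exact ⟨1, by simpa using h⟩
  | tail _ h ih =>
    obtain ⟨n, hn⟩ := ih
    exact ⟨n + 1, Matrix.pow_add_entry_pos hA hn (by simpa using h)⟩

/-- A strongly connected policy is a primitive matrix. -/
lemma SocialLearning.IsStronglyConnectedPolicy.exists_pow_pos [DecidableEq ι]
    (hA : IsStronglyConnectedPolicy A) : ∃ n, ∀ i j, 0 < (A ^ n) i j := by
  obtain ⟨m, hm⟩ := hA.self_loop
  have path : ∀ i j, ∃ n, 0 < (A ^ n) i j := fun i j => by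
    by_cases h : i = j
    · exact ⟨0, by simp [h]⟩
    · exact Matrix.exists_pow_entry_pos_of_transGen hA.nonneg (hA.connected i j h)
  have loop : ∀ s, 0 < (A ^ s) m m := fun s => by
    induction s with
    | zero => simp
    | succ s ih => exact Matrix.pow_add_entry_pos hA.nonneg ih (by simpa using hm)
  choose n hn using path
  let B := ∑ i, ∑ j, n i j
  have hB : ∀ i j, n i j ≤ B := fun i j =>
    (Finset.single_le_sum (f := fun j => n i j) (fun _ _ => Nat.zero_le _)
      (Finset.mem_univ j)).trans
    (Finset.single_le_sum (f := fun i => ∑ j, n i j) (fun _ _ => Nat.zero_le _)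
      (Finset.mem_univ i))
  -- Go from `i` to `m`, then from `m` to `j`, each in at most `B` steps, and pad with the self-loop
  -- at `m` to reach the common length `2 * B`.
  refine ⟨2 * B, fun i j => ?_⟩
  have h : 2 * B = n i m + (2 * B - n i m - n m j) + n m j := by
    have := hB i m
    have := hB m j
    lia
  rw [h]
  exact Matrix.pow_add_entry_pos hA.nonneg
    (Matrix.pow_add_entry_pos hA.nonneg (hn i m) (loop _)) (hn m j)

lemma SocialLearning.consensus_add (x : ι → ℝ) (s t : ℕ) :
    consensus A x (s + t) = consensus A (consensus A x s) t := by
  induction t with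
  | zero => rfl
  | succ t ih =>
    funext k
    change ∑ ℓ, A ℓ k * consensus A x (s + t) ℓ = _
    rw [ih]
    rfl

lemma SocialLearning.consensus_eq_pow [DecidableEq ι] (x : ι → ℝ) (t : ℕ) (k : ι) :
    consensus A x t k = ∑ ℓ, (A ^ t) ℓ k * x ℓ := by
  induction t generalizing k with
  | zero => simp [consensus, Matrix.one_apply]
  | succ t ih =>
    simp only [consensus, ih, pow_succ, Matrix.mul_apply, Finset.mul_sum, Finset.sum_mul]
    rw [Finset.sum_comm]
    exact Finset.sum_congr rfl fun i _ => Finset.sum_congr rfl fun j _ => by ring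

lemma SocialLearning.consensus_sub_const (hA : ∀ k, ∑ ℓ, A ℓ k = 1) (x : ι → ℝ) (c : ℝ) (t : ℕ)
    (k : ι) : consensus A (fun ℓ => x ℓ - c) t k = consensus A x t k - c := by
  induction t generalizing k with
  | zero => rfl
  | succ t ih => simp [consensus, ih, mul_sub, ← Finset.sum_mul, hA]

lemma SocialLearning.IsPerronVector.sum_consensus (hπ : IsPerronVector A π) (x : ι → ℝ) (t : ℕ) :
    ∑ k, π k * consensus A x t k = ∑ k, π k * x k := by
  induction t with
  | zero => rfl
  | succ t ih =>
    rw [← ih]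
    simp only [consensus, Finset.mul_sum]
    rw [Finset.sum_comm]
    refine Finset.sum_congr rfl fun ℓ _ => ?_
    conv_rhs => rw [← hπ.eigen]
    rw [Matrix.mulVec, dotProduct, Finset.sum_mul]
    exact Finset.sum_congr rfl fun k _ => by ring

lemma SocialLearning.norm_consensus_le (hA : IsStronglyConnectedPolicy A) (x : ι → ℝ) (t : ℕ) :
    ‖consensus A x t‖ ≤ ‖x‖ := by
  induction t with
  | zero => exact le_rfl
  | succ t ih =>
    refine (pi_norm_le_iff_of_nonneg (norm_nonneg _)).2 fun k => ?_
    calc ‖∑ ℓ, A ℓ k * consensus A x t ℓ‖ ≤ ∑ ℓ, A ℓ k * ‖x‖ := by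
          refine (norm_sum_le _ _).trans (Finset.sum_le_sum fun ℓ _ => ?_)
          rw [norm_mul, Real.norm_of_nonneg (hA.nonneg ℓ k)]
          exact mul_le_mul_of_nonneg_left ((norm_le_pi_norm _ ℓ).trans ih) (hA.nonneg ℓ k)
      _ = ‖x‖ := by rw [← Finset.sum_mul, hA.sum_col, one_mul]

/-- Doeblin's argument: every entry of a positive power is at least `ε ≥ ε * π ℓ`. Subtracting `ε *
π ℓ` changes nothing on vectors of zero `π`-average and leaves nonnegative weights with column sums
`1 - ε`. -/
lemma SocialLearning.exists_consensus_contraction (hA : IsStronglyConnectedPolicy A)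
    (hπ : IsPerronVector A π) : ∃ (n : ℕ) (q : ℝ), q < 1 ∧
      ∀ x : ι → ℝ, ∑ k, π k * x k = 0 → ‖consensus A x n‖ ≤ q * ‖x‖ := by
  classical
  obtain ⟨n, hn⟩ := hA.exists_pow_pos
  obtain ⟨m, -⟩ := hA.self_loop
  have hsum : ∀ k, ∑ ℓ, (A ^ n) ℓ k = 1 := fun k => by
    have h : consensus A (fun _ => 1) n k = 1 := by
      have h0 := consensus_sub_const hA.sum_col (fun _ => 1) 1 n k
      rw [consensus_eq_pow] at h0
      simp at h0
      linarith
    simpa [consensus_eq_pow] using h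
  obtain ⟨p, -, hp⟩ := Finset.exists_min_image (Finset.univ : Finset (ι × ι))
    (fun p => (A ^ n) p.1 p.2) ⟨(m, m), Finset.mem_univ _⟩
  have hε : 0 < (A ^ n) p.1 p.2 := hn _ _
  set ε := (A ^ n) p.1 p.2
  have hπ1 : ∀ ℓ, π ℓ ≤ 1 := fun ℓ => by
    rw [← hπ.sum_eq_one]
    exact Finset.single_le_sum (f := π) (fun i _ => (hπ.pos i).le) (Finset.mem_univ ℓ)
  refine ⟨n, 1 - ε, by linarith, fun x hx => ?_⟩
  have key : ∀ k, ‖consensus A x n k‖ ≤ (1 - ε) * ‖x‖ := fun k => by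
    have h : consensus A x n k = ∑ ℓ, ((A ^ n) ℓ k - ε * π ℓ) * x ℓ := by
      simp only [sub_mul, Finset.sum_sub_distrib, mul_assoc, ← Finset.mul_sum, hx,
        consensus_eq_pow]
      ring
    rw [h]
    calc ‖∑ ℓ, ((A ^ n) ℓ k - ε * π ℓ) * x ℓ‖ ≤ ∑ ℓ, ((A ^ n) ℓ k - ε * π ℓ) * ‖x‖ := by
          refine (norm_sum_le _ _).trans (Finset.sum_le_sum fun ℓ _ => ?_)
          have h0 : 0 ≤ (A ^ n) ℓ k - ε * π ℓ := by
            have h1 := hp (ℓ, k) (Finset.mem_univ _)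
            have h2 := mul_le_mul_of_nonneg_left (hπ1 ℓ) hε.le
            simp only at h1
            linarith
          rw [norm_mul, Real.norm_of_nonneg h0]
          exact mul_le_mul_of_nonneg_left (norm_le_pi_norm _ ℓ) h0
      _ = (1 - ε) * ‖x‖ := by
          rw [← Finset.sum_mul, Finset.sum_sub_distrib, hsum, ← Finset.mul_sum, hπ.sum_eq_one,
            mul_one]
  exact (pi_norm_le_iff_of_nonneg ((norm_nonneg _).trans (key m))).2 key

/-- The consensus rule leads every agent to the Perron average of the initial values. -/
theorem SocialLearning.tendsto_consensus (hA : IsStronglyConnectedPolicy A)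
    (hπ : IsPerronVector A π) (x : ι → ℝ) (k : ι) :
    Tendsto (fun t => consensus A x t k) atTop (𝓝 (∑ k, π k * x k)) := by
  set c := ∑ k, π k * x k with hc
  set y : ι → ℝ := fun k => x k - c with hy
  have hyπ : ∑ k, π k * y k = 0 := by
    simp [hy, mul_sub, ← Finset.sum_mul, hπ.sum_eq_one, hc]
  have hanti : Antitone fun t => ‖consensus A y t‖ := fun s t hst => by
    obtain ⟨u, rfl⟩ := Nat.exists_eq_add_of_le hst
    simp only [consensus_add]
    exact norm_consensus_le hA _ u
  obtain ⟨n, q, hq, hcontr⟩ := exists_consensus_contraction hA hπ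
  have hlim := tendsto_atTop_ciInf hanti ⟨0, by rintro _ ⟨t, rfl⟩; exact norm_nonneg _⟩
  set l := ⨅ t, ‖consensus A y t‖
  have hl0 : 0 ≤ l := ge_of_tendsto' hlim fun t => norm_nonneg _
  -- The norms decrease to a limit `l`; passing to the limit in the contraction over `n` further
  -- rounds forces `l = 0`, as `q < 1`.
  have hlq : l ≤ q * l := by
    refine le_of_tendsto_of_tendsto' ((tendsto_add_atTop_iff_nat n).2 hlim) (hlim.const_mul q)
      fun t => ?_
    simp only [consensus_add]
    exact hcontr _ (by rw [hπ.sum_consensus, hyπ])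
  have hl : l = 0 := by nlinarith
  rw [hl] at hlim
  have h := (tendsto_pi_nhds.1 (tendsto_zero_iff_norm_tendsto_zero.2 hlim) k).add_const c
  simpa [hy, consensus_sub_const hA.sum_col] using h

end Consensus

/-! ### Bounded differences -/

section BoundedDifferences

lemma MeasureTheory.integrable_of_abs_le {Ω : Type*} [MeasurableSpace Ω] {μ : Measure Ω}
    [IsFiniteMeasure μ] {f : Ω → ℝ} (hf : Measurable f) {K : ℝ} (hK : ∀ x, |f x| ≤ K) :
    Integrable f μ :=
  Integrable.of_mem_Icc (-K) K hf.aemeasurable (ae_of_all _ fun x => abs_le.1 (hK x))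

lemma MeasureTheory.abs_integral_le_of_abs_le {Ω : Type*} [MeasurableSpace Ω] {μ : Measure Ω}
    [IsProbabilityMeasure μ] {f : Ω → ℝ} {K : ℝ} (hK : ∀ x, |f x| ≤ K) :
    |∫ x, f x ∂μ| ≤ K := by
  simpa using norm_integral_le_of_norm_le_const (μ := μ) (f := f) (C := K) (ae_of_all _ hK)

/-- A function on a product is sub-Gaussian if its sections and their means are. -/
lemma ProbabilityTheory.HasSubgaussianMGF.prod_of_sections {α β : Type*} [MeasurableSpace α]
    [MeasurableSpace β] {ν : Measure α} {μ : Measure β} [IsProbabilityMeasure ν]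
    [IsProbabilityMeasure μ] {f : α × β → ℝ} (hf : Measurable f) {K : ℝ} (hK : ∀ p, |f p| ≤ K)
    {c₁ c₂ : ℝ≥0} (h₁ : ∀ b, HasSubgaussianMGF (fun a => f (a, b) - ∫ a, f (a, b) ∂ν) c₁ ν)
    (h₂ : HasSubgaussianMGF (fun b => ∫ a, f (a, b) ∂ν - ∫ b, ∫ a, f (a, b) ∂ν ∂μ) c₂ μ) :
    HasSubgaussianMGF (fun p => f p - ∫ p, f p ∂(ν.prod μ)) (c₁ + c₂) (ν.prod μ) := by
  have hint : ∫ p, f p ∂(ν.prod μ) = ∫ b, ∫ a, f (a, b) ∂ν ∂μ :=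
    integral_prod_symm f (integrable_of_abs_le hf hK)
  rw [hint]
  set m := ∫ b, ∫ a, f (a, b) ∂ν ∂μ
  have hexp : ∀ t : ℝ, Integrable (fun p => Real.exp (t * (f p - m))) (ν.prod μ) := fun t =>
    integrable_exp_mul_of_mem_Icc (a := -K - m) (b := K - m) (hf.sub_const _).aemeasurable
      (ae_of_all _ fun p => by
        have := abs_le.1 (hK p)
        exact ⟨by linarith, by linarith⟩)
  refine ⟨hexp, fun t => ?_⟩
  rw [mgf, integral_prod_symm _ (hexp t)]
  -- The fluctuation splits into that of the section about its mean and that of the section mean;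
  -- integrating out `a` first makes the two proxies add.
  have hsplit : ∀ b, ∫ a, Real.exp (t * (f (a, b) - m)) ∂ν =
      Real.exp (t * (∫ a, f (a, b) ∂ν - m)) *
        mgf (fun a => f (a, b) - ∫ a, f (a, b) ∂ν) ν t := fun b => by
    rw [mgf, ← integral_const_mul]
    refine integral_congr_ae (ae_of_all _ fun a => ?_)
    simp only [← Real.exp_add]
    congr 1
    ring
  calc ∫ b, ∫ a, Real.exp (t * (f (a, b) - m)) ∂ν ∂μ
      ≤ ∫ b, Real.exp (t * (∫ a, f (a, b) ∂ν - m)) * Real.exp (c₁ * t ^ 2 / 2) ∂μ := by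
        refine integral_mono (hexp t).integral_prod_right ((h₂.integrable_exp_mul t).mul_const _)
          fun b => ?_
        simp only [hsplit]
        exact mul_le_mul_of_nonneg_left ((h₁ b).mgf_le t) (Real.exp_pos _).le
    _ = mgf (fun b => ∫ a, f (a, b) ∂ν - m) μ t * Real.exp (c₁ * t ^ 2 / 2) :=
        integral_mul_const _ _
    _ ≤ Real.exp (c₂ * t ^ 2 / 2) * Real.exp (c₁ * t ^ 2 / 2) :=
        mul_le_mul_of_nonneg_right (h₂.mgf_le t) (Real.exp_pos _).le
    _ = Real.exp (↑(c₁ + c₂) * t ^ 2 / 2) := by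
        rw [← Real.exp_add]
        push_cast
        congr 1
        ring

/-- **McDiarmid's inequality**, as a bound on the moment generating function. -/
theorem ProbabilityTheory.hasSubgaussianMGF_of_bounded_differences {X : Type*}
    [MeasurableSpace X] (μ : Measure X) [IsProbabilityMeasure μ] {n : ℕ} {f : (Fin n → X) → ℝ}
    (hf : Measurable f) {K : ℝ} (hK : ∀ z, |f z| ≤ K) {c : ℝ≥0}
    (hc : ∀ z i x, f (Function.update z i x) ≤ f z + c) :
    HasSubgaussianMGF (fun z => f z - ∫ z, f z ∂(Measure.pi fun _ => μ)) (n * (c / 2) ^ 2)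
      (Measure.pi fun _ => μ) := by
  induction n with
  | zero =>
    have h : (fun z => f z - ∫ z, f z ∂(Measure.pi fun _ : Fin 0 => μ)) = fun _ => 0 := by
      funext z
      have : ∀ y, f y = f z := fun y => congrArg f (Subsingleton.elim _ _)
      simp [this]
    rw [h]
    simp
  | succ n ih =>
    obtain ⟨x₀⟩ : Nonempty X := nonempty_of_isProbabilityMeasure μ
    let g : X × (Fin n → X) → ℝ := fun p => f (Fin.cons p.1 p.2)
    have hmp := measurePreserving_piFinSuccAbove (fun _ : Fin (n + 1) => μ) 0
    have hcons : ∀ z : Fin (n + 1) → X,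
        g (MeasurableEquiv.piFinSuccAbove (fun _ => X) 0 z) = f z := fun z => by
      change f (Fin.cons (z 0) fun j => z (Fin.succAbove 0 j)) = f z
      congr 1
      exact Fin.cons_self_tail z
    have hg : Measurable g := by
      have : g = fun p => f ((MeasurableEquiv.piFinSuccAbove (fun _ => X) 0).symm p) := by
        funext p
        rw [← hcons, MeasurableEquiv.apply_symm_apply]
      rw [this]
      exact hf.comp (MeasurableEquiv.measurable _)
    have hgK : ∀ p, |g p| ≤ K := fun p => hK _
    have hg₁ : ∀ x x' y, g (x, y) ≤ g (x', y) + c := fun x x' y => by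
      simpa using hc (Fin.cons x' y) 0 x
    -- As a function of the first coordinate alone, `g` stays in an interval of length `c` above its
    -- infimum, so Hoeffding's lemma applies.
    have hsec : ∀ y, HasSubgaussianMGF (fun x => g (x, y) - ∫ x, g (x, y) ∂μ) ((c / 2) ^ 2) μ := by
      intro y
      have hbdd : BddBelow (Set.range fun x => g (x, y)) :=
        ⟨-K, by rintro _ ⟨x, rfl⟩; exact (abs_le.1 (hgK _)).1⟩
      have hne : Nonempty X := ⟨x₀⟩
      have h := hasSubgaussianMGF_of_mem_Icc (μ := μ) (X := fun x => g (x, y))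
        (a := ⨅ x, g (x, y)) (b := (⨅ x, g (x, y)) + c)
        (hg.comp measurable_prodMk_right).aemeasurable
        (ae_of_all _ fun x => ⟨ciInf_le hbdd x, by
          rw [← sub_le_iff_le_add]
          exact le_ciInf fun x' => by linarith [hg₁ x x' y]⟩)
      simpa using h
    -- Averaging over the first coordinate preserves the difference bound in the other `n`, so the
    -- induction needs no martingale.
    have hmean := ih (f := fun y => ∫ x, g (x, y) ∂μ)
      hg.stronglyMeasurable.integral_prod_left'.measurable
      (fun y => abs_integral_le_of_abs_le fun x => hgK _) (fun y i x => by
        have hi : ∀ y, Integrable (fun x => g (x, y)) μ := fun y =>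
          integrable_of_abs_le (hg.comp measurable_prodMk_right) fun x => hgK _
        have h : ∫ x', g (x', Function.update y i x) ∂μ ≤ ∫ x', (g (x', y) + c) ∂μ :=
          integral_mono (hi _) ((hi _).add (integrable_const _)) fun x' => by
            simpa [g, ← Fin.cons_update] using hc (Fin.cons x' y) i.succ x
        rwa [integral_add (hi _) (integrable_const _), integral_const, probReal_univ,
          one_smul] at h)
    have hprod := HasSubgaussianMGF.prod_of_sections hg hgK hsec hmean
    rw [← hmp.map_eq] at hprod
    have h := HasSubgaussianMGF.of_map hmp.measurable.aemeasurable hprod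
    have hint : ∫ p, g p ∂(Measure.map (MeasurableEquiv.piFinSuccAbove (fun _ => X) 0)
        (Measure.pi fun _ : Fin (n + 1) => μ)) = ∫ z, f z ∂(Measure.pi fun _ => μ) := by
      rw [integral_map hmp.measurable.aemeasurable hg.aestronglyMeasurable]
      simp only [hcons]
    rw [hint] at h
    convert h using 1
    · funext z
      rw [Function.comp_apply, hcons]
    · push_cast
      ring

/-- Weighted sums of possibly dependent sub-Gaussian variables. -/
lemma ProbabilityTheory.HasSubgaussianMGF.weighted_sum {Ω ι : Type*} [MeasurableSpace Ω]
    {P : Measure Ω} [IsProbabilityMeasure P] (s : Finset ι) {w : ι → ℝ} (hw : ∀ i, 0 ≤ w i)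
    {X : ι → Ω → ℝ} {c : ι → ℝ≥0} (h : ∀ i, HasSubgaussianMGF (X i) (c i ^ 2) P) :
    HasSubgaussianMGF (fun ω => ∑ i ∈ s, w i * X i ω)
      ((∑ i ∈ s, (w i).toNNReal * c i) ^ 2) P := by
  classical
  induction s using Finset.induction_on with
  | empty => simp
  | insert i s hi ih =>
    have h2 : (w i).toNNReal ^ 2 = NNReal.mk (w i ^ 2) (sq_nonneg _) := by
      ext
      simp [hw i]
    -- Without independence the square roots of the proxies add; hence the proxies are kept as
    -- squares.
    have h1 := ((h i).const_mul (w i)).add ih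
    change HasSubgaussianMGF _
      ((NNReal.sqrt (NNReal.mk (w i ^ 2) (sq_nonneg _) * c i ^ 2) + _) ^ 2) P at h1
    rw [← h2, ← mul_pow, NNReal.sqrt_sq, NNReal.sqrt_sq] at h1
    simpa only [Finset.sum_insert hi] using h1

end BoundedDifferences

/-! ### Uniform deviations over a class of functions -/

namespace SocialLearning

section Suprema

variable {J : Type*} {a b : J → ℝ} {K : ℝ}

lemma bddAbove_of_abs_le (ha : ∀ j, |a j| ≤ K) : BddAbove (Set.range a) :=
  ⟨K, by rintro _ ⟨j, rfl⟩; exact (abs_le.1 (ha j)).2⟩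

lemma abs_ciSup_le [Nonempty J] (ha : ∀ j, |a j| ≤ K) : |⨆ j, a j| ≤ K := by
  obtain ⟨j⟩ := ‹Nonempty J›
  exact abs_le.2 ⟨(abs_le.1 (ha j)).1.trans (le_ciSup (bddAbove_of_abs_le ha) j),
    ciSup_le fun j => (abs_le.1 (ha j)).2⟩

lemma ciSup_le_ciSup_add [Nonempty J] (hb : ∀ j, |b j| ≤ K) {e : ℝ} (h : ∀ j, a j ≤ b j + e) :
    ⨆ j, a j ≤ (⨆ j, b j) + e :=
  ciSup_le fun j => (h j).trans
    (add_le_add_left (le_ciSup (bddAbove_of_abs_le hb) j) e)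

lemma abs_sgn (b : Bool) : |sgn b| = 1 := by cases b <;> simp [sgn]

lemma sgn_not (b : Bool) : sgn (!b) = -sgn b := by cases b <;> simp [sgn]

lemma sgn_beq (b c : Bool) : sgn (b == c) = sgn b * sgn c := by
  cases b <;> cases c <;> simp [sgn]

lemma sgn_mul_self (b : Bool) : sgn b * sgn b = 1 := by cases b <;> simp [sgn]

lemma abs_sgn_mul (b : Bool) (x : ℝ) : |sgn b * x| = |x| := by rw [abs_mul, abs_sgn, one_mul]

lemma abs_sum_le_card_mul {n : ℕ} {u : Fin n → ℝ} (hu : ∀ i, |u i| ≤ K) : |∑ i, u i| ≤ n * K := by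
  refine (Finset.abs_sum_le_sum_abs _ _).trans ?_
  simpa using Finset.sum_le_card_nsmul Finset.univ (fun i => |u i|) K fun i _ => hu i

lemma abs_mean_le {n : ℕ} {u : Fin n → ℝ} (hK : 0 ≤ K) (hu : ∀ i, |u i| ≤ K) :
    |(n : ℝ)⁻¹ * ∑ i, u i| ≤ K := by
  rw [abs_mul, abs_of_nonneg (by positivity : (0 : ℝ) ≤ (n : ℝ)⁻¹)]
  rcases n.eq_zero_or_pos with rfl | hn
  · simpa using hK
  · rw [inv_mul_le_iff₀ (by positivity)]
    exact abs_sum_le_card_mul hu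

end Suprema

/-! ### Contraction for Rademacher averages -/

section Contraction

variable {J : Type*} [Nonempty J]

/-- The contraction step for one sign, averaged over its two values. For a pair `j, j'` the left
side gains at most `|w j - w j'|`, and the right side attains either sign of `w j - w j'` by
exchanging `j` and `j'`. -/
lemma ciSup_add_ciSup_sub_le {c v w : J → ℝ} {K B : ℝ} (hc : ∀ j, |c j| ≤ K)
    (hw : ∀ j, |w j| ≤ B) (hvw : ∀ j j', |v j - v j'| ≤ |w j - w j'|) :
    (⨆ j, (c j + v j)) + ⨆ j, (c j - v j) ≤ (⨆ j, (c j + w j)) + ⨆ j, (c j - w j) := by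
  have h1 : ∀ j, c j + w j ≤ ⨆ j, (c j + w j) := fun j =>
    le_ciSup (bddAbove_of_abs_le fun j => (abs_add_le _ _).trans (add_le_add (hc j) (hw j))) j
  have h2 : ∀ j, c j - w j ≤ ⨆ j, (c j - w j) := fun j =>
    le_ciSup (bddAbove_of_abs_le fun j => (abs_sub _ _).trans (add_le_add (hc j) (hw j))) j
  rw [← le_sub_iff_add_le]
  refine ciSup_le fun j => ?_
  rw [le_sub_comm]
  refine ciSup_le fun j' => ?_
  have := (le_abs_self _).trans (hvw j j')
  rcases abs_cases (w j - w j') with h | h <;> linarith [h1 j, h1 j', h2 j, h2 j']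

lemma sum_signs_succ {n : ℕ} (G : (Fin (n + 1) → Bool) → ℝ) :
    ∑ r, G r = ∑ r : Fin n → Bool, (G (Fin.cons true r) + G (Fin.cons false r)) := by
  rw [← (Fin.consEquiv fun _ => Bool).sum_comp, Fintype.sum_prod_type, Fintype.sum_bool,
    ← Finset.sum_add_distrib]
  rfl

/-- The **contraction principle** for Rademacher averages. -/
theorem sum_signs_ciSup_le_of_contraction {n : ℕ} {v w : Fin n → J → ℝ} {B : ℝ}
    (hv : ∀ i j, |v i j| ≤ B) (hw : ∀ i j, |w i j| ≤ B)
    (hvw : ∀ i j j', |v i j - v i j'| ≤ |w i j - w i j'|) {a : J → ℝ} {K : ℝ}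
    (ha : ∀ j, |a j| ≤ K) :
    ∑ r : Fin n → Bool, ⨆ j, (a j + ∑ i, sgn (r i) * v i j) ≤
      ∑ r : Fin n → Bool, ⨆ j, (a j + ∑ i, sgn (r i) * w i j) := by
  induction n generalizing a K with
  | zero => simp
  | succ n ih =>
    -- The free offset `a` absorbs coordinate `0` with its sign fixed, so the induction hypothesis
    -- replaces all other coordinates; coordinate `0` is then treated by pairing its two signs.
    have hstep : ∀ b : Bool,
        ∑ r : Fin n → Bool, ⨆ j, (a j + (sgn b * v 0 j + ∑ i, sgn (r i) * v i.succ j)) ≤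
          ∑ r : Fin n → Bool, ⨆ j, (a j + (sgn b * v 0 j + ∑ i, sgn (r i) * w i.succ j)) := by
      intro b
      have h := ih (v := fun i => v i.succ) (w := fun i => w i.succ) (fun i => hv _)
        (fun i => hw _) (fun i => hvw _) (a := fun j => a j + sgn b * v 0 j) (K := K + B)
        (fun j => (abs_add_le _ _).trans
          (add_le_add (ha j) ((abs_sgn_mul b _).trans_le (hv 0 j))))
      simpa only [add_assoc] using h
    rw [sum_signs_succ, sum_signs_succ]
    simp only [Fin.sum_univ_succ, Fin.cons_zero, Fin.cons_succ]
    calc _ ≤ ∑ r : Fin n → Bool,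
          ((⨆ j, (a j + (sgn true * v 0 j + ∑ i, sgn (r i) * w i.succ j))) +
            ⨆ j, (a j + (sgn false * v 0 j + ∑ i, sgn (r i) * w i.succ j))) := by
          rw [Finset.sum_add_distrib, Finset.sum_add_distrib]
          exact add_le_add (hstep true) (hstep false)
      _ ≤ _ := Finset.sum_le_sum fun r _ => by
          have h := ciSup_add_ciSup_sub_le (c := fun j => a j + ∑ i, sgn (r i) * w i.succ j)
            (K := K + n * B) (fun j => (abs_add_le _ _).trans (add_le_add (ha j)
              (abs_sum_le_card_mul fun i => (abs_sgn_mul _ _).trans_le (hw _ j))))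
            (hw 0) (hvw 0)
          simp only [sgn, if_true, Bool.false_eq_true, if_false, one_mul, neg_one_mul] at h ⊢
          calc _ = _ := by
                congr 1 <;> exact iSup_congr fun j => by ring
            _ ≤ _ := h
            _ = _ := by congr 1 <;> exact iSup_congr fun j => by ring

end Contraction

/-! ### Uniform deviations, ghost samples and symmetrization -/

section Deviation

variable {J X : Type*} [MeasurableSpace X]

lemma _root_.MeasureTheory.MeasurePreserving.integral_comp_measurable {α β : Type*}
    [MeasurableSpace α] [MeasurableSpace β] {μ : Measure α} {ν : Measure β} {e : α → β}
    (he : MeasurePreserving e μ ν) {f : β → ℝ} (hf : Measurable f) :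
    ∫ x, f (e x) ∂μ = ∫ y, f y ∂ν := by
  rw [← he.map_eq, integral_map he.measurable.aemeasurable hf.aestronglyMeasurable]

/-- A uniformly bounded family of measurable functions for which the suprema of linear combinations
of evaluations are measurable. -/
structure IsBoundedClass (ψ : J → X → ℝ) (B : ℝ) : Prop where
  nonneg : 0 ≤ B
  abs_le : ∀ j x, |ψ j x| ≤ B
  measurable : ∀ j, Measurable (ψ j)
  measurable_iSup : ∀ (n : ℕ) (a : Fin n → ℝ),
    Measurable fun z : Fin n → X => ⨆ j, ∑ i, a i * ψ j (z i)

/-- The empirical average of a function. -/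
noncomputable def average {n : ℕ} (z : Fin n → X) (f : X → ℝ) : ℝ := (n : ℝ)⁻¹ * ∑ i, f (z i)

/-- The expected uniform deviation of the averages over an independent sample from the averages
over the sample `z`. -/
noncomputable def ghostSup (ψ : J → X → ℝ) (μ : Measure X) {n : ℕ} (z : Fin n → X) : ℝ :=
  ∫ z', ⨆ j, (average z' (ψ j) - average z (ψ j)) ∂(Measure.pi fun _ : Fin n => μ)

/-- The supremum of the signed averages. -/
noncomputable def signedSup (ψ : J → X → ℝ) {n : ℕ} (r : Fin n → Bool) (z : Fin n → X) : ℝ :=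
  ⨆ j, (n : ℝ)⁻¹ * ∑ i, sgn (r i) * ψ j (z i)

omit [MeasurableSpace X] in
lemma average_update {n : ℕ} (z : Fin n → X) (i : Fin n) (x : X) (f : X → ℝ) :
    average (Function.update z i x) f = average z f + (f x - f (z i)) / n := by
  have h : ∑ k, f (Function.update z i x k) = ∑ k, f (z k) + (f x - f (z i)) := by
    rw [← Finset.add_sum_erase _ _ (Finset.mem_univ i),
      ← Finset.add_sum_erase _ (fun k => f (z k)) (Finset.mem_univ i), Function.update_self,
      Finset.sum_congr rfl fun k hk => by rw [Function.update_of_ne (Finset.ne_of_mem_erase hk)]]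
    ring
  rw [average, average, h]
  ring

lemma measurable_average {n : ℕ} {f : X → ℝ} (hf : Measurable f) :
    Measurable fun z : Fin n → X => average z f := by
  unfold average
  fun_prop

lemma integral_average (μ : Measure X) [IsProbabilityMeasure μ] {n : ℕ} (hn : 0 < n)
    {f : X → ℝ} (hf : Measurable f) {B : ℝ} (hB : ∀ x, |f x| ≤ B) :
    ∫ z, average z f ∂(Measure.pi fun _ : Fin n => μ) = ∫ x, f x ∂μ := by
  unfold average
  have h : ∀ i : Fin n, ∫ z, f (z i) ∂(Measure.pi fun _ : Fin n => μ) = ∫ x, f x ∂μ := fun i =>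
    (measurePreserving_eval (fun _ : Fin n => μ) i).integral_comp_measurable hf
  have hi : ∀ i : Fin n, Integrable (fun z => f (z i)) (Measure.pi fun _ : Fin n => μ) :=
    fun i => integrable_of_abs_le (by fun_prop) fun z => hB (z i)
  rw [integral_const_mul, integral_finsetSum _ fun i _ => hi i]
  have : (n : ℝ) ≠ 0 := by positivity
  simp [h, this]

variable {ψ : J → X → ℝ} {B : ℝ} {n : ℕ}

namespace IsBoundedClass

variable (hψ : IsBoundedClass ψ B)

include hψ

lemma abs_average_le (z : Fin n → X) (j : J) : |average z (ψ j)| ≤ B :=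
  abs_mean_le hψ.nonneg fun i => hψ.abs_le j (z i)

lemma abs_average_sub_le (z' z : Fin n → X) (j : J) :
    |average z' (ψ j) - average z (ψ j)| ≤ B + B :=
  (abs_sub _ _).trans (add_le_add (hψ.abs_average_le z' j) (hψ.abs_average_le z j))

lemma abs_signed_le (r : Fin n → Bool) (z : Fin n → X) (j : J) :
    |(n : ℝ)⁻¹ * ∑ i, sgn (r i) * ψ j (z i)| ≤ B :=
  abs_mean_le hψ.nonneg fun i => (abs_sgn_mul _ _).trans_le (hψ.abs_le j (z i))

lemma measurable_signedSup (r : Fin n → Bool) : Measurable (signedSup ψ r) := by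
  unfold signedSup
  simpa only [Finset.mul_sum, mul_assoc] using
    hψ.measurable_iSup n fun i => (n : ℝ)⁻¹ * sgn (r i)

lemma measurable_iSup_neg_average :
    Measurable fun z : Fin n → X => ⨆ j, -average z (ψ j) := by
  unfold average
  simpa only [Finset.mul_sum, neg_mul, ← Finset.sum_neg_distrib] using
    hψ.measurable_iSup n fun _ => -(n : ℝ)⁻¹

/-- Two samples are read as a single one of size `n + n`, to which the measurability of the class
applies. -/
lemma measurable_iSup_sub (r : Fin n → Bool) :
    Measurable fun p : (Fin n → X) × (Fin n → X) =>
      ⨆ j, (n : ℝ)⁻¹ * ∑ i, sgn (r i) * (ψ j (p.1 i) - ψ j (p.2 i)) := by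
  have h := hψ.measurable_iSup (n + n)
    (Fin.append (fun i => (n : ℝ)⁻¹ * sgn (r i)) fun i => -((n : ℝ)⁻¹ * sgn (r i)))
  have happ : Measurable fun p : (Fin n → X) × (Fin n → X) => Fin.append p.1 p.2 := by
    refine measurable_pi_iff.2 fun i => ?_
    refine Fin.addCases (fun i => ?_) (fun i => ?_) i
    · simp only [Fin.append_left]
      fun_prop
    · simp only [Fin.append_right]
      fun_prop
  convert h.comp happ using 1
  funext p
  refine iSup_congr fun j => ?_
  simp only [Fin.sum_univ_add, Fin.append_left, Fin.append_right, Finset.mul_sum,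
    ← Finset.sum_add_distrib]
  exact Finset.sum_congr rfl fun i _ => by ring

lemma measurable_iSup_average_sub :
    Measurable fun p : (Fin n → X) × (Fin n → X) =>
      ⨆ j, (average p.1 (ψ j) - average p.2 (ψ j)) := by
  simpa [sgn, average, mul_sub] using hψ.measurable_iSup_sub fun _ : Fin n => true

variable (μ : Measure X) [IsProbabilityMeasure μ]

lemma measurable_ghostSup : Measurable (ghostSup ψ μ (n := n)) :=
  hψ.measurable_iSup_average_sub.stronglyMeasurable.integral_prod_left'.measurable

variable [Nonempty J]

lemma abs_signedSup_le (r : Fin n → Bool) (z : Fin n → X) : |signedSup ψ r z| ≤ B :=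
  abs_ciSup_le fun j => hψ.abs_signed_le r z j

lemma abs_ghostSup_le (z : Fin n → X) : |ghostSup ψ μ z| ≤ B + B :=
  abs_integral_le_of_abs_le fun _ => abs_ciSup_le fun j => hψ.abs_average_sub_le _ z j

lemma integrable_iSup_average_sub (z : Fin n → X) :
    Integrable (fun z' => ⨆ j, (average z' (ψ j) - average z (ψ j)))
      (Measure.pi fun _ : Fin n => μ) := by
  have h := hψ.measurable_iSup_average_sub (n := n)
  have hz : Measurable fun z' : Fin n → X => (z', z) := by fun_prop
  have hm := h.comp hz
  have hb : ∀ z' : Fin n → X, |⨆ j, (average z' (ψ j) - average z (ψ j))| ≤ B + B :=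
    fun z' => abs_ciSup_le fun j => hψ.abs_average_sub_le z' z j
  exact integrable_of_abs_le hm hb

/-- An expectation of suprema dominates each expectation. Working with `ghostSup` instead of the
supremum of `∫ ψ j - average z (ψ j)` keeps measurability available: only evaluations on finitely
many points appear under the supremum. -/
lemma integral_sub_average_le_ghostSup (hn : 0 < n) (z : Fin n → X) (j : J) :
    ∫ x, ψ j x ∂μ - average z (ψ j) ≤ ghostSup ψ μ z := by
  have hint : Integrable (fun z' => average z' (ψ j)) (Measure.pi fun _ : Fin n => μ) :=
    integrable_of_abs_le (measurable_average (hψ.measurable j)) fun z => hψ.abs_average_le z j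
  have h : ∫ z', (average z' (ψ j) - average z (ψ j)) ∂(Measure.pi fun _ : Fin n => μ) ≤
      ghostSup ψ μ z :=
    integral_mono (hint.sub (integrable_const _)) (hψ.integrable_iSup_average_sub μ z) fun z' =>
      le_ciSup (bddAbove_of_abs_le fun j => hψ.abs_average_sub_le z' z j) j
  rwa [integral_sub hint (integrable_const _), integral_const, probReal_univ, one_smul,
    integral_average μ hn (hψ.measurable j) (hψ.abs_le j)] at h

lemma ghostSup_update_le {c : ℝ} (hc : ∀ j x y, ψ j x ≤ ψ j y + c) (z : Fin n → X) (i : Fin n)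
    (x : X) : ghostSup ψ μ (Function.update z i x) ≤ ghostSup ψ μ z + c / n := by
  have h : ghostSup ψ μ (Function.update z i x) ≤
      ∫ z', ((⨆ j, (average z' (ψ j) - average z (ψ j))) + c / n)
        ∂(Measure.pi fun _ : Fin n => μ) := by
    refine integral_mono (hψ.integrable_iSup_average_sub μ _)
      ((hψ.integrable_iSup_average_sub μ z).add (integrable_const _)) fun z' => ?_
    refine ciSup_le_ciSup_add (hψ.abs_average_sub_le z' z) fun j => ?_
    have hj : (ψ j (z i) - ψ j x) / n ≤ c / n :=
      div_le_div_of_nonneg_right (by linarith [hc j (z i) x]) n.cast_nonneg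
    rw [sub_div] at hj
    rw [average_update, sub_div]
    linarith
  rwa [integral_add (hψ.integrable_iSup_average_sub μ z) (integrable_const _), integral_const,
    probReal_univ, one_smul] at h

lemma iSup_neg_average_update_le {c : ℝ} (hc : ∀ j x y, ψ j x ≤ ψ j y + c) (z : Fin n → X)
    (i : Fin n) (x : X) :
    ⨆ j, -average z (ψ j) ≤ (⨆ j, -average (Function.update z i x) (ψ j)) + c / n := by
  refine ciSup_le_ciSup_add (fun j => (abs_neg _).trans_le (hψ.abs_average_le _ j)) fun j => ?_
  have hj : (ψ j x - ψ j (z i)) / n ≤ c / n :=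
    div_le_div_of_nonneg_right (by linarith [hc j x (z i)]) n.cast_nonneg
  rw [average_update]
  linarith

/-- **Symmetrization**. -/
theorem integral_ghostSup_le :
    ∫ z, ghostSup ψ μ z ∂(Measure.pi fun _ : Fin n => μ) ≤
      2 * ∫ z, ((2 : ℝ) ^ n)⁻¹ * ∑ r, signedSup ψ r z ∂(Measure.pi fun _ : Fin n => μ) := by
  set ν := Measure.pi fun _ : Fin n => μ
  let D : (Fin n → Bool) → (Fin n → X) × (Fin n → X) → ℝ := fun r p =>
    ⨆ j, (n : ℝ)⁻¹ * ∑ i, sgn (r i) * (ψ j (p.1 i) - ψ j (p.2 i))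
  have hDm : ∀ r, Measurable (D r) := hψ.measurable_iSup_sub
  have hDB : ∀ r p, |D r p| ≤ B + B := fun r p => abs_ciSup_le fun j =>
    abs_mean_le (add_nonneg hψ.nonneg hψ.nonneg) fun i => (abs_sgn_mul _ _).trans_le
      ((abs_sub _ _).trans (add_le_add (hψ.abs_le j _) (hψ.abs_le j _)))
  have hghost : ∫ z, ghostSup ψ μ z ∂ν = ∫ p, D (fun _ => true) p ∂(ν.prod ν) := by
    rw [integral_prod_symm _ (integrable_of_abs_le (hDm _) (hDB _))]
    simp [D, ghostSup, average, sgn, mul_sub, ν]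
  -- Exchanging the `i`-th points of the two samples wherever `r i` is `false` preserves the product
  -- law and flips the corresponding signs.
  have hswap : ∀ r, ∫ p, D (fun _ => true) p ∂(ν.prod ν) = ∫ p, D r p ∂(ν.prod ν) := fun r => by
    have he := measurePreserving_arrowProdEquivProdArrow X X (Fin n) (fun _ => μ) (fun _ => μ)
    have hs : MeasurePreserving
        (fun (w : Fin n → X × X) i => (if r i then id else Prod.swap : X × X → X × X) (w i))
        (Measure.pi fun _ => μ.prod μ) (Measure.pi fun _ => μ.prod μ) :=
      measurePreserving_pi _ _ fun i => by
        cases r i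
        · exact Measure.measurePreserving_swap
        · exact MeasurePreserving.id _
    rw [← he.integral_comp', ← he.integral_comp']
    refine (hs.integral_comp_measurable
      ((hDm fun _ => true).comp (MeasurableEquiv.measurable _))).symm.trans ?_
    refine integral_congr_ae (ae_of_all _ fun w => iSup_congr fun j => ?_)
    congr 1
    refine Finset.sum_congr rfl fun i _ => ?_
    cases h : r i <;> simp [MeasurableEquiv.arrowProdEquivProdArrow,
      Equiv.arrowProdEquivProdArrow, h, sgn]
  have hsi : ∀ r, Integrable (signedSup ψ r) ν := fun r =>
    integrable_of_abs_le (hψ.measurable_signedSup r) (hψ.abs_signedSup_le r)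
  have hle : ∀ r, ∫ p, D r p ∂(ν.prod ν) ≤
      ∫ z, signedSup ψ r z ∂ν + ∫ z, signedSup ψ (fun i => !r i) z ∂ν := fun r => by
    have h1 : Integrable (fun p : (Fin n → X) × (Fin n → X) => signedSup ψ r p.1) (ν.prod ν) :=
      integrable_of_abs_le ((hψ.measurable_signedSup r).comp measurable_fst)
        fun p => hψ.abs_signedSup_le r p.1
    have h2 : Integrable (fun p : (Fin n → X) × (Fin n → X) => signedSup ψ (fun i => !r i) p.2)
        (ν.prod ν) :=
      integrable_of_abs_le ((hψ.measurable_signedSup _).comp measurable_snd)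
        fun p => hψ.abs_signedSup_le _ p.2
    calc ∫ p, D r p ∂(ν.prod ν)
        ≤ ∫ p, (signedSup ψ r p.1 + signedSup ψ (fun i => !r i) p.2) ∂(ν.prod ν) := by
          refine integral_mono (integrable_of_abs_le (hDm r) (hDB r)) (h1.add h2) fun p => ?_
          refine ciSup_le fun j => ?_
          have e : (n : ℝ)⁻¹ * ∑ i, sgn (r i) * (ψ j (p.1 i) - ψ j (p.2 i)) =
              (n : ℝ)⁻¹ * ∑ i, sgn (r i) * ψ j (p.1 i) +
                (n : ℝ)⁻¹ * ∑ i, sgn (!r i) * ψ j (p.2 i) := by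
            rw [← mul_add, ← Finset.sum_add_distrib]
            congr 1
            exact Finset.sum_congr rfl fun i _ => by rw [sgn_not]; ring
          rw [e]
          exact add_le_add (le_ciSup (bddAbove_of_abs_le (hψ.abs_signed_le r p.1)) j)
            (le_ciSup (bddAbove_of_abs_le (hψ.abs_signed_le (fun i => !r i) p.2)) j)
      _ = _ := by
          rw [integral_add h1 h2, integral_fun_fst (μ := ν) (ν := ν) (signedSup ψ r),
            integral_fun_snd (μ := ν) (ν := ν) (signedSup ψ fun i => !r i)]
          simp
  -- Negating all signs permutes the sign patterns, so the two samples contribute equally.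
  have hneg : ∑ r : Fin n → Bool, ∫ z, signedSup ψ (fun i => !r i) z ∂ν =
      ∑ r : Fin n → Bool, ∫ z, signedSup ψ r z ∂ν :=
    Fintype.sum_equiv (Equiv.piCongrRight fun _ => Equiv.boolNot) _ _ fun r => rfl
  have hsum : (2 : ℝ) ^ n * ∫ z, ghostSup ψ μ z ∂ν ≤ 2 * ∑ r, ∫ z, signedSup ψ r z ∂ν := by
    calc (2 : ℝ) ^ n * ∫ z, ghostSup ψ μ z ∂ν
        = ∑ r : Fin n → Bool, ∫ p, D r p ∂(ν.prod ν) := by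
          rw [hghost, Finset.sum_congr rfl fun r _ => (hswap r).symm]
          simp
      _ ≤ _ := (Finset.sum_le_sum fun r _ => hle r).trans_eq (by
          rw [Finset.sum_add_distrib, hneg, two_mul])
  rw [integral_const_mul, integral_finsetSum _ fun r _ => hsi r]
  have h2 : (0 : ℝ) < 2 ^ n := by positivity
  calc _ = ((2 : ℝ) ^ n)⁻¹ * (2 ^ n * ∫ z, ghostSup ψ μ z ∂ν) := by field_simp
    _ ≤ ((2 : ℝ) ^ n)⁻¹ * (2 * ∑ r, ∫ z, signedSup ψ r z ∂ν) :=
        mul_le_mul_of_nonneg_left hsum (by positivity)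
    _ = _ := by ring

end IsBoundedClass

end Deviation

end SocialLearning

/-! ### The training phase of a single agent -/

namespace SocialLearning

section Agent

variable {H : Type*} [MeasurableSpace H] (L : Bool → Measure H)

instance isProbabilityMeasure_trainLaw [∀ γ, IsProbabilityMeasure (L γ)] :
    IsProbabilityMeasure (trainLaw L) := by
  have h : ∀ b, IsProbabilityMeasure ((L b).map fun h => (h, b)) := fun b =>
    Measure.isProbabilityMeasure_map (by fun_prop)
  refine ⟨?_⟩
  simp only [trainLaw, Measure.smul_apply, Measure.add_apply, measure_univ, smul_eq_mul]
  rw [one_add_one_eq_two]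
  exact ENNReal.inv_mul_cancel (by norm_num) (by norm_num)

lemma measurable_sgn : Measurable sgn := measurable_of_countable _

lemma integral_trainLaw [∀ γ, IsProbabilityMeasure (L γ)] {g : H × Bool → ℝ} (hg : Measurable g)
    {K : ℝ} (hK : ∀ x, |g x| ≤ K) :
    ∫ x, g x ∂(trainLaw L) = (∫ h, g (h, true) ∂(L true) + ∫ h, g (h, false) ∂(L false)) / 2 := by
  have h : ∀ b, IsProbabilityMeasure ((L b).map fun h => (h, b)) := fun b =>
    Measure.isProbabilityMeasure_map (by fun_prop)
  rw [trainLaw, integral_smul_measure, integral_add_measure (integrable_of_abs_le hg hK)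
    (integrable_of_abs_le hg hK), integral_map (by fun_prop) hg.aestronglyMeasurable,
    integral_map (by fun_prop) hg.aestronglyMeasurable]
  simp only [ENNReal.toReal_inv, ENNReal.toReal_ofNat, smul_eq_mul]
  ring

variable {L} {F : Set (H → ℝ)} {φ : ℝ → ℝ} {Lφ : ℝ≥0} {β : ℝ}

/-- The composition of the loss with the functions of the class. -/
noncomputable def lossClass (φ : ℝ → ℝ) (F : Set (H → ℝ)) (f : F) (x : H × Bool) : ℝ :=
  φ (sgn x.2 * (f : H → ℝ) x.1)

/-- The functions of the class and their negatives. -/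
noncomputable def signClass (F : Set (H → ℝ)) (f : F × Bool) (x : H × Bool) : ℝ :=
  sgn f.2 * (f.1 : H → ℝ) x.1

/-- There are only finitely many label patterns, and for each of them the sum is a continuous
function of evaluations at the features. -/
lemma IsMeasurableClass.measurable_iSup_labelled (hF : IsMeasurableClass F)
    {θ : Bool → ℝ → ℝ} (hθ : ∀ b, Continuous (θ b)) (n : ℕ) (a : Fin n → ℝ) :
    Measurable fun z : Fin n → H × Bool =>
      ⨆ f : F, ∑ i, a i * θ (z i).2 ((f : H → ℝ) (z i).1) := by
  have h : Measurable fun p : (Fin n → H) × (Fin n → Bool) =>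
      ⨆ f : F, ∑ i, a i * θ (p.2 i) ((f : H → ℝ) (p.1 i)) :=
    measurable_from_prod_countable_left fun b =>
      hF.2 n (fun v => ∑ i, a i * θ (b i) (v i)) (by fun_prop)
  exact h.comp (MeasurableEquiv.arrowProdEquivProdArrow H Bool (Fin n)).measurable

lemma IsAdmissibleLoss.continuous (hφ : IsAdmissibleLoss φ Lφ) : Continuous φ :=
  hφ.lipschitz.continuous

lemma IsAdmissibleLoss.abs_sub_le (hφ : IsAdmissibleLoss φ Lφ) (x y : ℝ) :
    |φ x - φ y| ≤ Lφ * |x - y| := hφ.lipschitz.dist_le_mul x y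

lemma IsAdmissibleLoss.lipschitz_pos (hφ : IsAdmissibleLoss φ Lφ) : 0 < (Lφ : ℝ) := by
  refine Lφ.coe_nonneg.lt_of_ne fun h => hφ.deriv_neg.ne ?_
  have hconst : φ = fun _ => φ 0 := funext fun x => by
    have := hφ.abs_sub_le x 0
    rw [← h, zero_mul] at this
    linarith [abs_nonpos_iff.1 this]
  rw [hconst, deriv_const]

lemma isBoundedClass_lossClass (hφ : IsAdmissibleLoss φ Lφ) (hF : IsMeasurableClass F)
    (hβ : ∀ f ∈ F, ∀ h, |f h| ≤ β) : IsBoundedClass (lossClass φ F) (φ (-β)) where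
  nonneg := hφ.nonneg _
  abs_le f x := by
    rw [lossClass, abs_of_nonneg (hφ.nonneg _)]
    exact hφ.antitone (abs_le.1 ((abs_sgn_mul _ _).trans_le (hβ f f.2 x.1))).1
  measurable f := hφ.continuous.measurable.comp ((measurable_sgn.comp measurable_snd).mul
    ((hF.1 f f.2).comp measurable_fst))
  measurable_iSup n a := hF.measurable_iSup_labelled (θ := fun b v => φ (sgn b * v))
    (fun b => hφ.continuous.comp (continuous_const.mul continuous_id)) n a

/-- With the negatives included, one supremum controls deviations of both signs. It is the maximum
of the suprema over `F` with coefficients `a` and `-a`, which gives its measurability. -/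
lemma isBoundedClass_signClass [Nonempty F] (hβ₀ : 0 ≤ β) (hF : IsMeasurableClass F)
    (hβ : ∀ f ∈ F, ∀ h, |f h| ≤ β) : IsBoundedClass (signClass F) β where
  nonneg := hβ₀
  abs_le f x := (abs_sgn_mul _ _).trans_le (hβ f.1 f.1.2 x.1)
  measurable f := ((hF.1 f.1 f.1.2).comp measurable_fst).const_mul _
  measurable_iSup n a := by
    let S : (Fin n → ℝ) → (Fin n → H × Bool) → ℝ := fun a z =>
      ⨆ f : F, ∑ i, a i * (f : H → ℝ) (z i).1
    have hS : ∀ a, Measurable (S a) := fun a =>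
      hF.measurable_iSup_labelled (θ := fun _ v => v) (fun _ => continuous_id) n a
    have hbdd : ∀ (a : Fin n → ℝ) (z : Fin n → H × Bool) (f : F),
        |∑ i, a i * (f : H → ℝ) (z i).1| ≤ ∑ i, |a i| * β := fun a z f =>
      (Finset.abs_sum_le_sum_abs _ _).trans (Finset.sum_le_sum fun i _ => by
        rw [abs_mul]
        exact mul_le_mul_of_nonneg_left (hβ f f.2 _) (abs_nonneg _))
    convert (hS a).max (hS (-a)) using 1
    funext z
    have htrue : ∀ f : F, ∑ i, a i * signClass F (f, true) (z i) =
        ∑ i, a i * (f : H → ℝ) (z i).1 := fun f => by simp [signClass, sgn]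
    have hfalse : ∀ f : F, ∑ i, a i * signClass F (f, false) (z i) =
        ∑ i, (-a) i * (f : H → ℝ) (z i).1 := fun f => by simp [signClass, sgn]
    have hle : ∀ p : F × Bool, ∑ i, a i * signClass F p (z i) ≤ max (S a z) (S (-a) z) := by
      rintro ⟨f, b⟩
      cases b
      · rw [hfalse]
        exact le_max_of_le_right (le_ciSup (bddAbove_of_abs_le (hbdd (-a) z)) f)
      · rw [htrue]
        exact le_max_of_le_left (le_ciSup (bddAbove_of_abs_le (hbdd a z)) f)
    have hb : BddAbove (Set.range fun p : F × Bool => ∑ i, a i * signClass F p (z i)) :=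
      ⟨_, by rintro _ ⟨p, rfl⟩; exact hle p⟩
    refine le_antisymm (ciSup_le hle) (max_le (ciSup_le fun f => ?_) (ciSup_le fun f => ?_))
    · rw [← htrue]
      exact le_ciSup hb (f, true)
    · rw [← hfalse]
      exact le_ciSup hb (f, false)

/-! ### Expected deviations in terms of Rademacher complexity -/

section Rademacher

variable {n : ℕ}

omit [MeasurableSpace H] in
lemma abs_signed_average_le (hβ₀ : 0 ≤ β) (hβ : ∀ f ∈ F, ∀ h, |f h| ≤ β) (r : Fin n → Bool)
    (h : Fin n → H) (f : F) :
    |(n : ℝ)⁻¹ * ∑ i, sgn (r i) * (f : H → ℝ) (h i)| ≤ β :=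
  abs_mean_le hβ₀ fun _ => (abs_sgn_mul _ _).trans_le (hβ f f.2 _)

lemma rademacher_nonneg : 0 ≤ rademacher L F n :=
  integral_nonneg fun z => mul_nonneg (by positivity)
    (Finset.sum_nonneg fun r _ => Real.iSup_nonneg fun f => abs_nonneg _)

lemma integrable_empRademacher [Nonempty F] [∀ γ, IsProbabilityMeasure (L γ)] (hβ₀ : 0 ≤ β)
    (hF : IsMeasurableClass F) (hβ : ∀ f ∈ F, ∀ h, |f h| ≤ β) :
    Integrable (fun z : Fin n → H × Bool => empRademacher F fun i => (z i).1)
      (Measure.pi fun _ => trainLaw L) := by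
  refine Integrable.const_mul (integrable_finsetSum _ fun r _ => ?_) _
  refine integrable_of_abs_le (K := β) ?_ fun z => abs_ciSup_le fun f =>
    (abs_abs _).trans_le (abs_signed_average_le hβ₀ hβ r (fun i => (z i).1) f)
  have h := hF.2 n (fun v => |(n : ℝ)⁻¹ * ∑ i, sgn (r i) * v i|) (by fun_prop)
  exact h.comp (g := fun h : Fin n → H =>
    ⨆ f : F, |(n : ℝ)⁻¹ * ∑ i, sgn (r i) * (f : H → ℝ) (h i)|)
    (f := fun z : Fin n → H × Bool => fun i => (z i).1) (by fun_prop)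

/-- Symmetrization leaves a comparison of sign sums at each fixed sample; it is used with `C = 1`
for the signed class and `C = Lφ` for the loss class. -/
lemma integral_ghostSup_le_of_sum_signedSup_le [Nonempty F] [∀ γ, IsProbabilityMeasure (L γ)]
    (hβ₀ : 0 ≤ β) (hF : IsMeasurableClass F) (hβ : ∀ f ∈ F, ∀ h, |f h| ≤ β) {J : Type*}
    [Nonempty J] {ψ : J → H × Bool → ℝ} {B : ℝ} (hψ : IsBoundedClass ψ B) {C : ℝ}
    (h : ∀ z : Fin n → H × Bool, ∑ r, signedSup ψ r z ≤
      C * ∑ r : Fin n → Bool, ⨆ f : F, |(n : ℝ)⁻¹ * ∑ i, sgn (r i) * (f : H → ℝ) (z i).1|) :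
    ∫ z, ghostSup ψ (trainLaw L) z ∂(Measure.pi fun _ : Fin n => trainLaw L) ≤
      2 * (C * rademacher L F n) := by
  refine (hψ.integral_ghostSup_le _).trans (mul_le_mul_of_nonneg_left ?_ zero_le_two)
  rw [rademacher, ← integral_const_mul]
  refine integral_mono (Integrable.const_mul (integrable_finsetSum _ fun r _ =>
    integrable_of_abs_le (hψ.measurable_signedSup r) (hψ.abs_signedSup_le r)) _)
    ((integrable_empRademacher hβ₀ hF hβ).const_mul _) fun z => ?_
  simp only [empRademacher]
  rw [mul_left_comm]
  exact mul_le_mul_of_nonneg_left (h z) (by positivity)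

lemma integral_ghostSup_signClass_le [Nonempty F] [∀ γ, IsProbabilityMeasure (L γ)]
    (hβ₀ : 0 ≤ β) (hF : IsMeasurableClass F) (hβ : ∀ f ∈ F, ∀ h, |f h| ≤ β) :
    ∫ z, ghostSup (signClass F) (trainLaw L) z ∂(Measure.pi fun _ : Fin n => trainLaw L) ≤
      2 * rademacher L F n := by
  have h := integral_ghostSup_le_of_sum_signedSup_le (L := L) (n := n) (C := 1) hβ₀ hF hβ
    (isBoundedClass_signClass hβ₀ hF hβ) fun z => by
      rw [one_mul]
      refine Finset.sum_le_sum fun r _ => ciSup_le fun p => ?_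
      refine le_trans ?_ (le_ciSup (bddAbove_of_abs_le fun f => (abs_abs _).trans_le
        (abs_signed_average_le hβ₀ hβ r (fun i => (z i).1) f)) p.1)
      rw [← abs_sgn_mul p.2]
      refine le_trans (le_of_eq ?_) (le_abs_self _)
      simp only [signClass, Finset.mul_sum]
      exact Finset.sum_congr rfl fun i _ => by ring
  rwa [one_mul] at h

/-- Contraction replaces the loss by `Lφ` times its argument. The label factors are then absorbed by
the bijection multiplying each sign by the label, and the absolute value can only enlarge the
supremum. -/
lemma integral_ghostSup_lossClass_le [Nonempty F] [∀ γ, IsProbabilityMeasure (L γ)]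
    (hφ : IsAdmissibleLoss φ Lφ) (hβ₀ : 0 ≤ β) (hF : IsMeasurableClass F)
    (hβ : ∀ f ∈ F, ∀ h, |f h| ≤ β) :
    ∫ z, ghostSup (lossClass φ F) (trainLaw L) z ∂(Measure.pi fun _ : Fin n => trainLaw L) ≤
      2 * (Lφ * rademacher L F n) := by
  refine integral_ghostSup_le_of_sum_signedSup_le hβ₀ hF hβ
    (isBoundedClass_lossClass hφ hF hβ) fun z => ?_
  have hn : (0 : ℝ) ≤ (n : ℝ)⁻¹ := by positivity
  let v : Fin n → F → ℝ := fun i f => (n : ℝ)⁻¹ * lossClass φ F f (z i)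
  let w : Fin n → F → ℝ := fun i f =>
    (n : ℝ)⁻¹ * (Lφ * (sgn (z i).2 * (f : H → ℝ) (z i).1))
  have hv : ∀ i f, |v i f| ≤ (n : ℝ)⁻¹ * (φ (-β) + Lφ * β) := fun i f => by
    rw [abs_mul, abs_of_nonneg hn]
    refine mul_le_mul_of_nonneg_left ?_ hn
    have := (isBoundedClass_lossClass hφ hF hβ).abs_le f (z i)
    have : 0 ≤ Lφ * β := mul_nonneg Lφ.coe_nonneg hβ₀
    linarith
  have hw : ∀ i f, |w i f| ≤ (n : ℝ)⁻¹ * (φ (-β) + Lφ * β) := fun i f => by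
    rw [abs_mul, abs_of_nonneg hn, abs_mul, abs_of_nonneg Lφ.coe_nonneg, abs_sgn_mul]
    refine mul_le_mul_of_nonneg_left ?_ hn
    have := mul_le_mul_of_nonneg_left (hβ f f.2 (z i).1) Lφ.coe_nonneg
    linarith [hφ.nonneg (-β)]
  have hvw : ∀ i f f', |v i f - v i f'| ≤ |w i f - w i f'| := fun i f f' => by
    simp only [v, w, lossClass, ← mul_sub]
    rw [abs_mul, abs_mul, abs_mul, abs_of_nonneg Lφ.coe_nonneg, mul_sub]
    exact mul_le_mul_of_nonneg_left (hφ.abs_sub_le _ _) (abs_nonneg _)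
  have hcontr := sum_signs_ciSup_le_of_contraction hv hw hvw (a := fun _ => 0) (K := 0) (by simp)
  simp only [zero_add] at hcontr
  calc ∑ r, signedSup (lossClass φ F) r z
      = ∑ r : Fin n → Bool, ⨆ f, ∑ i, sgn (r i) * v i f := by
        refine Finset.sum_congr rfl fun r _ => iSup_congr fun f => ?_
        rw [Finset.mul_sum]
        exact Finset.sum_congr rfl fun i _ => by simp only [v]; ring
    _ ≤ ∑ r : Fin n → Bool, ⨆ f, ∑ i, sgn (r i) * w i f := hcontr
    _ ≤ ∑ r : Fin n → Bool, Lφ * ⨆ f : F,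
          |(n : ℝ)⁻¹ * ∑ i, sgn (r i == (z i).2) * (f : H → ℝ) (z i).1| := by
        refine Finset.sum_le_sum fun r _ => ciSup_le fun f => ?_
        have e : ∑ i, sgn (r i) * w i f =
            Lφ * ((n : ℝ)⁻¹ * ∑ i, sgn (r i == (z i).2) * (f : H → ℝ) (z i).1) := by
          simp only [Finset.mul_sum, w, sgn_beq]
          exact Finset.sum_congr rfl fun i _ => by ring
        rw [e]
        refine mul_le_mul_of_nonneg_left ((le_abs_self _).trans (le_ciSup
          (f := fun f : F => |(n : ℝ)⁻¹ * ∑ i, sgn (r i == (z i).2) * (f : H → ℝ) (z i).1|)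
          (bddAbove_of_abs_le fun f => (abs_abs _).trans_le (abs_signed_average_le hβ₀ hβ
            (fun i => r i == (z i).2) (fun i => (z i).1) f)) f)) Lφ.coe_nonneg
    _ = _ := by
        rw [← Finset.mul_sum]
        congr 1
        have hinv : Function.Involutive fun (r : Fin n → Bool) i => r i == (z i).2 :=
          fun r => funext fun i => by
            change ((r i == (z i).2) == (z i).2) = r i
            cases r i <;> cases (z i).2 <;> rfl
        exact Fintype.sum_equiv hinv.toPerm _ _ fun r => rfl

end Rademacher

/-! ### Excess risk and concentration of the suprema -/

section Concentration

variable {n : ℕ} [∀ γ, IsProbabilityMeasure (L γ)]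

/-- A bound on the excess risk of an empirical risk minimizer. -/
noncomputable def excessRiskBound (φ : ℝ → ℝ) (L : Bool → Measure H) (F : Set (H → ℝ))
    (z : Fin n → H × Bool) : ℝ :=
  ghostSup (lossClass φ F) (trainLaw L) z - (⨆ f, -average z (lossClass φ F f)) -
    targetRisk φ L F

/-- The negated supremum is the smallest empirical risk, which the minimizer attains, and `ghostSup`
dominates the gap between its expected and empirical risks. -/
lemma risk_le_excessRiskBound_add (hφ : IsAdmissibleLoss φ Lφ) (hF : IsMeasurableClass F)
    (hβ : ∀ f ∈ F, ∀ h, |f h| ≤ β) (hn : 0 < n) {T : (Fin n → H × Bool) → H → ℝ}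
    {z : Fin n → H × Bool} (hT : MinimizesEmpRisk φ F T z) :
    risk φ L (T z) ≤ excessRiskBound φ L F z + targetRisk φ L F := by
  have : Nonempty F := ⟨⟨_, hT.1⟩⟩
  have h1 : risk φ L (T z) - average z (lossClass φ F ⟨T z, hT.1⟩) ≤
      ghostSup (lossClass φ F) (trainLaw L) z :=
    (isBoundedClass_lossClass hφ hF hβ).integral_sub_average_le_ghostSup (trainLaw L) hn z
      ⟨T z, hT.1⟩
  have h2 : (⨆ f, -average z (lossClass φ F f)) ≤ -average z (lossClass φ F ⟨T z, hT.1⟩) :=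
    ciSup_le fun f => neg_le_neg (hT.2 f f.2)
  rw [excessRiskBound]
  linarith

lemma measurable_excessRiskBound (hφ : IsAdmissibleLoss φ Lφ) (hF : IsMeasurableClass F)
    (hβ : ∀ f ∈ F, ∀ h, |f h| ≤ β) : Measurable (excessRiskBound φ L F (n := n)) :=
  (((isBoundedClass_lossClass hφ hF hβ).measurable_ghostSup _).sub
    (isBoundedClass_lossClass hφ hF hβ).measurable_iSup_neg_average).sub_const _

/-- The expected minimum of the empirical risk is at most the minimum of its expectation, the target
risk. Hence only one one-sided deviation has to be symmetrized, not two. -/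
lemma integral_excessRiskBound_le [Nonempty F] (hφ : IsAdmissibleLoss φ Lφ) (hβ₀ : 0 ≤ β)
    (hF : IsMeasurableClass F) (hβ : ∀ f ∈ F, ∀ h, |f h| ≤ β) (hn : 0 < n) :
    ∫ z, excessRiskBound φ L F z ∂(Measure.pi fun _ : Fin n => trainLaw L) ≤
      2 * (Lφ * rademacher L F n) := by
  have hψ := isBoundedClass_lossClass hφ hF hβ
  have h1 : Integrable (ghostSup (lossClass φ F) (trainLaw L))
      (Measure.pi fun _ : Fin n => trainLaw L) :=
    integrable_of_abs_le (hψ.measurable_ghostSup _) (hψ.abs_ghostSup_le _)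
  have h2 : Integrable (fun z => ⨆ f, -average z (lossClass φ F f))
      (Measure.pi fun _ : Fin n => trainLaw L) :=
    integrable_of_abs_le hψ.measurable_iSup_neg_average fun z =>
      abs_ciSup_le fun f => (abs_neg _).trans_le (hψ.abs_average_le z f)
  have h3 : -targetRisk φ L F ≤
      ∫ z, ⨆ f, -average z (lossClass φ F f) ∂(Measure.pi fun _ : Fin n => trainLaw L) := by
    rw [neg_le]
    refine le_ciInf fun f => ?_
    rw [neg_le]
    have h4 : ∫ z, -average z (lossClass φ F f) ∂(Measure.pi fun _ : Fin n => trainLaw L) =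
        -risk φ L f := by
      rw [integral_neg, integral_average _ hn (hψ.measurable f) (hψ.abs_le f)]
      rfl
    rw [← h4]
    exact integral_mono (integrable_of_abs_le (measurable_average (hψ.measurable f)).neg
      fun z => (abs_neg _).trans_le (hψ.abs_average_le z f)) h2 fun z =>
      le_ciSup (bddAbove_of_abs_le fun f => (abs_neg _).trans_le (hψ.abs_average_le z f)) f
  have h5 := integral_ghostSup_lossClass_le (L := L) (n := n) hφ hβ₀ hF hβ
  have h6 := integral_sub (h1.sub h2) (integrable_const (targetRisk φ L F))
  simp only [Pi.sub_apply] at h6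
  simp only [excessRiskBound]
  rw [h6, integral_sub h1 h2, integral_const,
    probReal_univ, one_smul]
  linarith

/-- Increments `2 * b / n` in `n` coordinates give the proxy `n * (b / n) ^ 2 = b ^ 2 / n`, written
as a square to suit `HasSubgaussianMGF.weighted_sum`. -/
lemma hasSubgaussianMGF_of_increment (hn : 0 < n) {V : (Fin n → H × Bool) → ℝ}
    (hV : Measurable V) {K : ℝ} (hK : ∀ z, |V z| ≤ K) {b : ℝ≥0}
    (hb : ∀ z i x, V (Function.update z i x) ≤ V z + 2 * b / n) :
    HasSubgaussianMGF (fun z => V z - ∫ z, V z ∂(Measure.pi fun _ => trainLaw L))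
      ((b / NNReal.sqrt n) ^ 2) (Measure.pi fun _ => trainLaw L) := by
  convert hasSubgaussianMGF_of_bounded_differences (trainLaw L) hV hK (c := 2 * b / n)
    (by simpa using hb) using 1
  have hn' : (n : ℝ≥0) ≠ 0 := by positivity
  rw [div_pow, NNReal.sq_sqrt]
  field_simp

lemma hasSubgaussianMGF_ghostSup_signClass [Nonempty F] {β : ℝ≥0} (hF : IsMeasurableClass F)
    (hβ : ∀ f ∈ F, ∀ h, |f h| ≤ β) (hn : 0 < n) :
    HasSubgaussianMGF (fun z => ghostSup (signClass F) (trainLaw L) z -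
        ∫ z, ghostSup (signClass F) (trainLaw L) z ∂(Measure.pi fun _ : Fin n => trainLaw L))
      ((β / NNReal.sqrt n) ^ 2) (Measure.pi fun _ : Fin n => trainLaw L) := by
  have hψ := isBoundedClass_signClass β.coe_nonneg hF hβ
  refine hasSubgaussianMGF_of_increment hn (hψ.measurable_ghostSup _) (hψ.abs_ghostSup_le _)
    (hψ.ghostSup_update_le _ fun f x y => ?_)
  linarith [(abs_le.1 (hψ.abs_le f x)).2, (abs_le.1 (hψ.abs_le f y)).1]

lemma hasSubgaussianMGF_excessRiskBound [Nonempty F] {β : ℝ≥0} (hφ : IsAdmissibleLoss φ Lφ)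
    (hF : IsMeasurableClass F) (hβ : ∀ f ∈ F, ∀ h, |f h| ≤ β) (hn : 0 < n) :
    HasSubgaussianMGF (fun z => excessRiskBound φ L F z -
        ∫ z, excessRiskBound φ L F z ∂(Measure.pi fun _ : Fin n => trainLaw L))
      ((2 * Lφ * β / NNReal.sqrt n) ^ 2) (Measure.pi fun _ : Fin n => trainLaw L) := by
  have hψ := isBoundedClass_lossClass hφ hF hβ
  have hc : ∀ f x y, lossClass φ F f x ≤ lossClass φ F f y + Lφ * (2 * β) := fun f x y => by
    have h1 := (le_abs_self _).trans (hφ.abs_sub_le (sgn x.2 * (f : H → ℝ) x.1)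
      (sgn y.2 * (f : H → ℝ) y.1))
    have h2 : |sgn x.2 * (f : H → ℝ) x.1 - sgn y.2 * (f : H → ℝ) y.1| ≤ 2 * β := by
      refine (abs_sub _ _).trans ?_
      rw [abs_sgn_mul, abs_sgn_mul, two_mul]
      exact add_le_add (hβ f f.2 _) (hβ f f.2 _)
    have h3 := mul_le_mul_of_nonneg_left h2 Lφ.coe_nonneg
    simp only [lossClass]
    linarith
  refine hasSubgaussianMGF_of_increment hn (measurable_excessRiskBound hφ hF hβ)
    (K := φ (-β) + φ (-β) + φ (-β) + |targetRisk φ L F|) (fun z => ?_) fun z i x => ?_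
  · refine (abs_sub _ _).trans (add_le_add_left ((abs_sub _ _).trans
      (add_le_add (hψ.abs_ghostSup_le _ z) ?_)) _)
    exact abs_ciSup_le fun f => (abs_neg _).trans_le (hψ.abs_average_le z f)
  · have h1 := hψ.ghostSup_update_le (trainLaw L) hc z i x
    have h2 := hψ.iSup_neg_average_update_le hc z i x
    -- The ghost supremum and the minimal empirical risk each move by at most `2 * Lφ * β / n`,
    -- whence the scale `b = 2 * Lφ * β`.
    have h3 : 2 * ((2 * Lφ * β : ℝ≥0) : ℝ) / n = Lφ * (2 * β) / n + Lφ * (2 * β) / n := by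
      push_cast
      ring
    rw [h3]
    simp only [excessRiskBound]
    linarith

end Concentration

end Agent

end SocialLearning

/-! ### The training phase of the network -/

namespace SocialLearning

/-! ### The critical margin -/

section Difficulty

variable {φ : ℝ → ℝ} {Lφ : ℝ≥0}

/-- The loss term of `gapFn` is non-decreasing, so its slope is at least one. This makes the
solution for `dStar` unique and locates it within `|δ - gapFn φ Lφ R 0|` of the origin. -/
lemma IsAdmissibleLoss.sub_le_gapFn_sub (hφ : IsAdmissibleLoss φ Lφ) (R : ℝ) {x y : ℝ}
    (h : x ≤ y) : y - x ≤ gapFn φ Lφ R y - gapFn φ Lφ R x := by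
  have h1 : (φ y - R) / (2 * Lφ) ≤ (φ x - R) / (2 * Lφ) :=
    div_le_div_of_nonneg_right (sub_le_sub_right (hφ.antitone h) R) (by positivity)
  simp only [gapFn]
  linarith

/-- The critical margin solves its defining equation. -/
lemma IsAdmissibleLoss.gapFn_dStar (hφ : IsAdmissibleLoss φ Lφ) (R δ : ℝ) :
    gapFn φ Lφ R (dStar φ Lφ R δ) = δ := by
  have hcont : Continuous (gapFn φ Lφ R) := by
    have := hφ.continuous
    unfold gapFn
    fun_prop
  set e := |δ - gapFn φ Lφ R 0| with he
  have h1 := hφ.sub_le_gapFn_sub R (neg_nonpos.2 (abs_nonneg (δ - gapFn φ Lφ R 0)))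
  have h2 := hφ.sub_le_gapFn_sub R (abs_nonneg (δ - gapFn φ Lφ R 0))
  rw [← he] at h1 h2
  have h3 := abs_le.1 he.ge
  obtain ⟨d, -, hd⟩ := intermediate_value_Icc (by linarith [abs_nonneg (δ - gapFn φ Lφ R 0)] :
    -e ≤ e) hcont.continuousOn ⟨by linarith [h3.1], by linarith [h3.2]⟩
  have hset : {d | gapFn φ Lφ R d = δ} = {d} := by
    refine Set.eq_singleton_iff_unique_mem.2 ⟨hd, fun x hx => ?_⟩
    rcases le_total x d with h | h <;> have := hφ.sub_le_gapFn_sub R h <;>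
      rw [hd, (hx : gapFn φ Lφ R x = δ), sub_self] at this <;> linarith
  rw [dStar, hset, csInf_singleton, hd]

/-- This is the defining equation rearranged: the excess risk allowed at the critical margin is `2 *
Lφ` times the allowed deviation of the centre, `4 * difficulty`. -/
lemma IsAdmissibleLoss.loss_dStar (hφ : IsAdmissibleLoss φ Lφ) (R δ : ℝ) :
    φ (dStar φ Lφ R δ) = R + 8 * Lφ * difficulty φ Lφ R δ := by
  have h := hφ.gapFn_dStar R δ
  have hL := hφ.lipschitz_pos
  rw [gapFn, sub_eq_iff_eq_add, ← sub_eq_iff_eq_add', eq_div_iff (by positivity)] at h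
  rw [difficulty]
  linarith

end Difficulty

section Network

variable {ι : Type*} [Fintype ι] {π : ι → ℝ} {N : ι → ℕ}

lemma le_Nmax (k : ι) : N k ≤ Nmax N := Finset.le_sup (Finset.mem_univ k)

/-- The source of `imbalance`: the scales of dependent agents add to `∑ k, π k * b / √(N k)`, and
`√x ≤ x` for the ratio `x = Nmax N / N k ≥ 1`. -/
lemma sqrt_Nmax_mul_sum_le (hπ : ∀ k, 0 < π k) (hN : ∀ k, 0 < N k) (b : ℝ≥0) :
    √(Nmax N) * ∑ k, π k * (b / √(N k)) ≤ b * imbalance π N := by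
  rw [imbalance, Finset.mul_sum, Finset.mul_sum]
  refine Finset.sum_le_sum fun k _ => ?_
  have hk : (0 : ℝ) < N k := by exact_mod_cast hN k
  have h1 : (1 : ℝ) ≤ Nmax N / N k := by
    rw [one_le_div hk]
    exact_mod_cast le_Nmax k
  have h2 : √(Nmax N) / √(N k) ≤ Nmax N / N k := by
    rw [← Real.sqrt_div' _ hk.le]
    exact (Real.sqrt_le_left (by positivity)).2 (by nlinarith)
  calc √(Nmax N) * (π k * (b / √(N k))) = b * (π k * (√(Nmax N) / √(N k))) := by ring
    _ ≤ _ := mul_le_mul_of_nonneg_left (mul_le_mul_of_nonneg_left h2 (hπ k).le) b.coe_nonneg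

/-- A tail bound for the network average of possibly dependent sub-Gaussian statistics. -/
theorem measureReal_network_average_ge_le [Nonempty ι] (hπ : ∀ k, 0 < π k) (hN : ∀ k, 0 < N k)
    {Ω : Type*} [MeasurableSpace Ω] {P : Measure Ω} [IsProbabilityMeasure P] {V : ι → Ω → ℝ}
    {m : ι → ℝ} {b : ℝ≥0} (hb : 0 < b)
    (hV : ∀ k, HasSubgaussianMGF (fun ω => V k ω - m k) ((b / NNReal.sqrt (N k)) ^ 2) P)
    {M τ : ℝ} (hm : ∑ k, π k * m k ≤ M) (hM : M ≤ τ) :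
    P.real {ω | τ ≤ ∑ k, π k * V k ω} ≤
      Real.exp (-(Nmax N * (τ - M) ^ 2 / (2 * (b ^ 2 * imbalance π N ^ 2)))) := by
  have h := (HasSubgaussianMGF.weighted_sum Finset.univ (fun k => (hπ k).le) hV).measure_ge_le
    (sub_nonneg.2 hM)
  refine (measureReal_mono fun ω hω => ?_).trans (h.trans (Real.exp_le_exp.2 ?_))
  · simp only [Set.mem_ofPred_eq, mul_sub, Finset.sum_sub_distrib] at hω ⊢
    linarith
  · have hpos : ∀ k, (0 : ℝ) < N k := fun k => by exact_mod_cast hN k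
    have hS : 0 < ∑ k, π k * (b / √(N k)) := Finset.sum_pos (fun k _ => mul_pos (hπ k)
      (div_pos hb (Real.sqrt_pos.2 (hpos k)))) Finset.univ_nonempty
    have hle := pow_le_pow_left₀ (by positivity) (sqrt_Nmax_mul_sum_le hπ hN b) 2
    rw [mul_pow, mul_pow, Real.sq_sqrt (Nat.cast_nonneg _)] at hle
    obtain ⟨k⟩ := ‹Nonempty ι›
    have hNmax : (0 : ℝ) < Nmax N := (hpos k).trans_le (by exact_mod_cast le_Nmax k)
    have hden := (mul_pos hNmax (pow_pos hS 2)).trans_le hle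
    have hcoe : (((∑ k, (π k).toNNReal * (b / NNReal.sqrt (N k))) ^ 2 : ℝ≥0) : ℝ) =
        (∑ k, π k * (b / √(N k))) ^ 2 := by
      push_cast
      congr 1
      exact Finset.sum_congr rfl fun k _ => by simp [(hπ k).le]
    rw [hcoe, neg_div, neg_le_neg_iff, div_le_div_iff₀ (by positivity) (by positivity)]
    nlinarith [mul_le_mul_of_nonneg_left hle (sq_nonneg (τ - M))]

variable {H : ι → Type*} [∀ k, MeasurableSpace (H k)] {L : ∀ k, Bool → Measure (H k)}
  [∀ k γ, IsProbabilityMeasure (L k γ)] {φ : ℝ → ℝ} {Lφ : ℝ≥0} {F : ∀ k, Set (H k → ℝ)} {β : ℝ}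

omit [∀ k γ, IsProbabilityMeasure (L k γ)] in
lemma netRademacher_nonneg (hπ : ∀ k, 0 < π k) : 0 ≤ netRademacher π L F N :=
  Finset.sum_nonneg fun k _ => mul_nonneg (hπ k).le rademacher_nonneg

/-- Jensen's inequality: with uniform labels, the expected value of label times `f` is half the
difference of the class means. -/
lemma loss_half_sub_le_risk {H : Type*} [MeasurableSpace H] {L : Bool → Measure H}
    [∀ γ, IsProbabilityMeasure (L γ)] (hφ : IsAdmissibleLoss φ Lφ) {f : H → ℝ}
    (hf : Measurable f) (hβ : ∀ h, |f h| ≤ β) :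
    φ ((∫ h, f h ∂(L true) - ∫ h, f h ∂(L false)) / 2) ≤ risk φ L f := by
  have hg : Measurable fun x : H × Bool => sgn x.2 * f x.1 :=
    (measurable_sgn.comp measurable_snd).mul (hf.comp measurable_fst)
  have hgβ : ∀ x : H × Bool, |sgn x.2 * f x.1| ≤ β := fun x =>
    (abs_sgn_mul _ _).trans_le (hβ x.1)
  have h := hφ.convex.map_integral_le (μ := trainLaw L) hφ.continuous.continuousOn isClosed_univ
    (ae_of_all _ fun x => Set.mem_univ _) (integrable_of_abs_le hg hgβ)
    (integrable_of_abs_le (K := φ (-β)) (hφ.continuous.measurable.comp hg) fun x => by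
      rw [Function.comp_apply, abs_of_nonneg (hφ.nonneg _)]
      exact hφ.antitone (abs_le.1 (hgβ x)).1)
  rw [integral_trainLaw L hg hgβ] at h
  simpa [sgn, integral_neg, sub_eq_add_neg, risk] using h

/-- The training mean ignores the labels, so its expectation is the midpoint of the two class means.
-/
lemma abs_half_add_sub_empMean_le {H : Type*} [MeasurableSpace H] {L : Bool → Measure H}
    [∀ γ, IsProbabilityMeasure (L γ)] {F : Set (H → ℝ)} (hβ₀ : 0 ≤ β) (hF : IsMeasurableClass F)
    (hβ : ∀ f ∈ F, ∀ h, |f h| ≤ β) {n : ℕ} (hn : 0 < n) (z : Fin n → H × Bool) {f : H → ℝ}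
    (hf : f ∈ F) :
    |(∫ h, f h ∂(L true) + ∫ h, f h ∂(L false)) / 2 - empMean z f| ≤
      ghostSup (signClass F) (trainLaw L) z := by
  have : Nonempty F := ⟨⟨f, hf⟩⟩
  have hψ := isBoundedClass_signClass hβ₀ hF hβ
  have h := fun b => hψ.integral_sub_average_le_ghostSup (trainLaw L) hn z (⟨f, hf⟩, b)
  have hint : ∫ x, f x.1 ∂(trainLaw L) = (∫ h, f h ∂(L true) + ∫ h, f h ∂(L false)) / 2 :=
    integral_trainLaw L (g := fun x => f x.1) ((hF.1 f hf).comp measurable_fst)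
      fun x => hβ f hf x.1
  have h1 := h true
  have h2 := h false
  simp only [signClass, average, sgn, if_true, Bool.false_eq_true, if_false, one_mul, neg_one_mul,
    integral_neg, Finset.sum_neg_distrib, mul_neg, hint] at h1 h2
  rw [abs_le, empMean]
  constructor <;> linarith

/-- Training is margin consistent if the uniform deviations are small. -/
lemma marginConsistent_of_lt (hπ : ∀ k, 0 < π k) (hπ1 : ∑ k, π k = 1)
    (hφ : IsAdmissibleLoss φ Lφ) (hβ₀ : 0 ≤ β) (hF : ∀ k, IsMeasurableClass (F k))
    (hβ : ∀ k, ∀ f ∈ F k, ∀ h, |f h| ≤ β) (hN : ∀ k, 0 < N k)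
    {T : ∀ k, (Fin (N k) → H k × Bool) → H k → ℝ} {z : ∀ k, Fin (N k) → H k × Bool}
    (hT : ∀ k, MinimizesEmpRisk φ (F k) (T k) (z k)) {δ : ℝ}
    (hmean : ∑ k, π k * ghostSup (signClass (F k)) (trainLaw (L k)) (z k) <
      4 * difficulty φ Lφ (netTargetRisk π φ L F) δ)
    (hrisk : ∑ k, π k * excessRiskBound φ (L k) (F k) (z k) <
      8 * Lφ * difficulty φ Lφ (netTargetRisk π φ L F) δ) :
    MarginConsistent π L δ T z := by
  set R := netTargetRisk π φ L F with hR
  set d := dStar φ Lφ R δ with hd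
  have hdiff : 4 * difficulty φ Lφ R δ = d - δ := by rw [difficulty]; ring
  have hloss := hφ.loss_dStar R δ
  set mp := netMean π L true fun k => T k (z k) with hmp
  set mn := netMean π L false fun k => T k (z k) with hmn
  set me := netEmpMean π z fun k => T k (z k) with hme
  -- Otherwise monotonicity and Jensen give `φ d ≤ φ ((mp - mn) / 2) ≤` network risk `< R + 8 * Lφ *
  -- difficulty φ Lφ R δ = φ d`.
  have hgap : d < (mp - mn) / 2 := by
    by_contra! hle
    have h1 : φ ((mp - mn) / 2) ≤ ∑ k, π k * risk φ (L k) (T k (z k)) := by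
      have e : (mp - mn) / 2 = ∑ k, π k •
          ((∫ h, T k (z k) h ∂(L k true) - ∫ h, T k (z k) h ∂(L k false)) / 2) := by
        simp only [hmp, hmn, netMean, ← Finset.sum_sub_distrib, Finset.sum_div, smul_eq_mul]
        exact Finset.sum_congr rfl fun k _ => by ring
      rw [e]
      refine (hφ.convex.map_sum_le (fun k _ => (hπ k).le) hπ1 fun k _ => Set.mem_univ _).trans
        (Finset.sum_le_sum fun k _ => ?_)
      exact mul_le_mul_of_nonneg_left (loss_half_sub_le_risk hφ ((hF k).1 _ (hT k).1)
        (hβ k _ (hT k).1)) (hπ k).le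
    have h2 : ∑ k, π k * risk φ (L k) (T k (z k)) ≤
        ∑ k, π k * excessRiskBound φ (L k) (F k) (z k) + R := by
      rw [hR, netTargetRisk, ← Finset.sum_add_distrib]
      refine Finset.sum_le_sum fun k _ => ?_
      rw [← mul_add]
      exact mul_le_mul_of_nonneg_left
        (risk_le_excessRiskBound_add hφ (hF k) (hβ k) (hN k) (hT k)) (hπ k).le
    linarith [hφ.antitone hle]
  -- A half-width above `d` and a centre off by less than `d - δ` leave more than `δ` on either side
  -- of `me`.
  have hcenter : |(mp + mn) / 2 - me| < d - δ := by
    refine lt_of_le_of_lt ?_ (hmean.trans_eq hdiff)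
    have e : (mp + mn) / 2 - me = ∑ k, π k *
        ((∫ h, T k (z k) h ∂(L k true) + ∫ h, T k (z k) h ∂(L k false)) / 2 -
          empMean (z k) (T k (z k))) := by
      simp only [hmp, hmn, hme, netMean, netEmpMean, ← Finset.sum_add_distrib, Finset.sum_div,
        ← Finset.sum_sub_distrib]
      exact Finset.sum_congr rfl fun k _ => by ring
    rw [e]
    refine (Finset.abs_sum_le_sum_abs _ _).trans (Finset.sum_le_sum fun k _ => ?_)
    rw [abs_mul, abs_of_pos (hπ k)]
    exact mul_le_mul_of_nonneg_left
      (abs_half_add_sub_empMean_le hβ₀ (hF k) (hβ k) (hN k) (z k) (hT k).1) (hπ k).le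
  rw [abs_lt] at hcenter
  exact ⟨by change me + δ < mp; linarith, by change mn < me - δ; linarith⟩

variable {Ω : Type*} [MeasurableSpace Ω] {P : Measure Ω} [IsProbabilityMeasure P]

/-- Training is margin consistent with high probability. -/
theorem measureReal_not_marginConsistent_le (hπ : ∀ k, 0 < π k) (hπ1 : ∑ k, π k = 1)
    (hφ : IsAdmissibleLoss φ Lφ) (hβ₀ : 0 < β) (hF : ∀ k, IsMeasurableClass (F k))
    (hβ : ∀ k, ∀ f ∈ F k, ∀ h, |f h| ≤ β) (hN : ∀ k, 0 < N k)
    {Z : ∀ k, Fin (N k) → Ω → H k × Bool} (hZ : ∀ k n, Measurable (Z k n))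
    (hZlaw : ∀ k n, P.map (Z k n) = trainLaw (L k)) (hZind : ∀ k, iIndepFun (Z k) P)
    {T : ∀ k, (Fin (N k) → H k × Bool) → H k → ℝ}
    (hT : ∀ᵐ ω ∂P, ∀ k, MinimizesEmpRisk φ (F k) (T k) (fun n => Z k n ω)) {δ : ℝ}
    (hρ : netRademacher π L F N < difficulty φ Lφ (netTargetRisk π φ L F) δ) :
    P.real {ω | ¬ MarginConsistent π L δ T fun k n => Z k n ω} ≤
      2 * Real.exp (-(8 * (Nmax N : ℝ) / (imbalance π N ^ 2 * β ^ 2) *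
        (difficulty φ Lφ (netTargetRisk π φ L F) δ - netRademacher π L F N) ^ 2)) := by
  have hne : Nonempty ι := by
    by_contra h
    rw [not_nonempty_iff] at h
    simp at hπ1
  have hFne : ∀ k, Nonempty (F k) := fun k => by
    obtain ⟨ω, hω⟩ := hT.exists
    exact ⟨⟨_, (hω k).1⟩⟩
  have hlaw : ∀ k, P.map (fun ω n => Z k n ω) = Measure.pi fun _ => trainLaw (L k) := fun k => by
    rw [(iIndepFun_iff_map_fun_eq_pi_map fun n => (hZ k n).aemeasurable).1 (hZind k)]
    simp only [hZlaw]
  have hZm : ∀ k, Measurable fun ω n => Z k n ω := fun k => measurable_pi_iff.2 (hZ k)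
  lift β to ℝ≥0 using hβ₀.le
  have hρ0 : 0 ≤ netRademacher π L F N := netRademacher_nonneg hπ
  have hL := hφ.lipschitz_pos
  set ρ := netRademacher π L F N with hρdef
  set E := difficulty φ Lφ (netTargetRisk π φ L F) δ
  have hmean := measureReal_network_average_ge_le hπ hN (P := P)
    (V := fun k ω => ghostSup (signClass (F k)) (trainLaw (L k)) fun n => Z k n ω)
    (m := fun k => ∫ z, ghostSup (signClass (F k)) (trainLaw (L k)) z
      ∂(Measure.pi fun _ : Fin (N k) => trainLaw (L k)))
    (M := 2 * ρ) (τ := 4 * E) (NNReal.coe_pos.1 hβ₀) (fun k => by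
      have h := hasSubgaussianMGF_ghostSup_signClass (L := L k) (hF k) (hβ k) (hN k)
      rw [← hlaw] at h
      have h' := HasSubgaussianMGF.of_map (hZm k).aemeasurable h
      rwa [hlaw] at h') (by
      rw [hρdef, netRademacher, Finset.mul_sum]
      refine Finset.sum_le_sum fun k _ => ?_
      rw [mul_left_comm]
      exact mul_le_mul_of_nonneg_left
        (integral_ghostSup_signClass_le β.coe_nonneg (hF k) (hβ k)) (hπ k).le) (by linarith)
  have hrisk := measureReal_network_average_ge_le hπ hN (P := P) (b := 2 * Lφ * β)
    (V := fun k ω => excessRiskBound φ (L k) (F k) fun n => Z k n ω)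
    (m := fun k => ∫ z, excessRiskBound φ (L k) (F k) z
      ∂(Measure.pi fun _ : Fin (N k) => trainLaw (L k)))
    (M := 2 * (Lφ * ρ)) (τ := 8 * Lφ * E)
    (mul_pos (mul_pos two_pos (NNReal.coe_pos.1 hL)) (NNReal.coe_pos.1 hβ₀)) (fun k => by
      have h := hasSubgaussianMGF_excessRiskBound (L := L k) hφ (hF k) (hβ k) (hN k)
      rw [← hlaw] at h
      have h' := HasSubgaussianMGF.of_map (hZm k).aemeasurable h
      rwa [hlaw] at h') (by
      rw [hρdef, netRademacher, Finset.mul_sum, Finset.mul_sum]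
      refine Finset.sum_le_sum fun k _ => ?_
      have h := mul_le_mul_of_nonneg_left
        (integral_excessRiskBound_le (L := L k) hφ β.coe_nonneg (hF k) (hβ k) (hN k)) (hπ k).le
      linarith) (by nlinarith)
  have hsub : ∀ᵐ ω ∂P, ω ∈ {ω | ¬ MarginConsistent π L δ T fun k n => Z k n ω} → ω ∈
      {ω | 4 * E ≤ ∑ k, π k * ghostSup (signClass (F k)) (trainLaw (L k)) fun n => Z k n ω} ∪
        {ω | 8 * Lφ * E ≤ ∑ k, π k * excessRiskBound φ (L k) (F k) fun n => Z k n ω} := by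
    filter_upwards [hT] with ω hω hC
    by_contra h
    simp only [Set.mem_union, Set.mem_ofPred_eq, not_or, not_le] at h
    exact hC (marginConsistent_of_lt hπ hπ1 hφ β.coe_nonneg hF hβ hN hω h.1 h.2)
  have hexp : 8 * (Nmax N : ℝ) / (imbalance π N ^ 2 * β ^ 2) * (E - ρ) ^ 2 =
      8 * (Nmax N * (E - ρ) ^ 2 / (β ^ 2 * imbalance π N ^ 2)) := by ring
  -- Apart from this common factor the exponents are `(4 * E - 2 * ρ) ^ 2 / 2` and `(8 * E - 2 * ρ)
  -- ^ 2 / 8`; both are at least `8 * (E - ρ) ^ 2` because `0 ≤ ρ < E`.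
  have hbase : (0 : ℝ) ≤ Nmax N / (β ^ 2 * imbalance π N ^ 2) := by positivity
  rw [hexp, two_mul]
  refine (ENNReal.toReal_mono (measure_ne_top _ _) (measure_mono_ae hsub)).trans
    ((measureReal_union_le _ _).trans (add_le_add (hmean.trans ?_) (hrisk.trans ?_)))
  · refine Real.exp_le_exp.2 (neg_le_neg ?_)
    have e : (Nmax N : ℝ) * (4 * E - 2 * ρ) ^ 2 / (2 * (β ^ 2 * imbalance π N ^ 2)) =
        Nmax N / (β ^ 2 * imbalance π N ^ 2) * ((4 * E - 2 * ρ) ^ 2 / 2) := by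
      field_simp
    have e' : 8 * ((Nmax N : ℝ) * (E - ρ) ^ 2 / (β ^ 2 * imbalance π N ^ 2)) =
        Nmax N / (β ^ 2 * imbalance π N ^ 2) * (8 * (E - ρ) ^ 2) := by ring
    rw [e, e']
    exact mul_le_mul_of_nonneg_left (by nlinarith) hbase
  · refine Real.exp_le_exp.2 (neg_le_neg ?_)
    have e : (Nmax N : ℝ) * (8 * Lφ * E - 2 * (Lφ * ρ)) ^ 2 /
        (2 * (((2 * Lφ * β : ℝ≥0) : ℝ) ^ 2 * imbalance π N ^ 2)) =
        Nmax N / (β ^ 2 * imbalance π N ^ 2) * ((8 * E - 2 * ρ) ^ 2 / 8) := by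
      push_cast
      field_simp
      ring
    have e' : 8 * ((Nmax N : ℝ) * (E - ρ) ^ 2 / (β ^ 2 * imbalance π N ^ 2)) =
        Nmax N / (β ^ 2 * imbalance π N ^ 2) * (8 * (E - ρ) ^ 2) := by ring
    rw [e, e']
    exact mul_le_mul_of_nonneg_left (by nlinarith) hbase

end Network

end SocialLearning

/-! ### The prediction phase -/

namespace SocialLearning

section Prediction

variable {ι : Type*} [Fintype ι] {π : ι → ℝ} {H : ι → Type*} [∀ k, MeasurableSpace (H k)]

/-- Hoeffding's inequality for the ensemble of local statistics. -/
lemma measureReal_pi_ensemble_nonpos_le (hπ : ∀ k, 0 < π k) {μ : ∀ k, Measure (H k)}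
    [∀ k, IsProbabilityMeasure (μ k)] {u : ∀ k, H k → ℝ} (hu : ∀ k, Measurable (u k)) {β : ℝ}
    (hβ₀ : 0 ≤ β) (hβ : ∀ k h, |u k h| ≤ β) (c : ι → ℝ) (γ : Bool) {δ : ℝ} (hδ : 0 ≤ δ)
    (hmargin : δ ≤ sgn γ * ∑ k, π k * (∫ h, u k h ∂(μ k) - c k)) :
    (Measure.pi μ).real {h | sgn γ * ∑ k, π k * (u k (h k) - c k) ≤ 0} ≤
      Real.exp (-(δ ^ 2 / (2 * β ^ 2 * ∑ k, π k ^ 2))) := by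
  lift β to ℝ≥0 using hβ₀
  let p : ι → ℝ≥0 := fun k => (π k).toNNReal
  -- The sign is reversed so that misclassification becomes an upper tail event. A statistic with
  -- values in `[-β, β]` has proxy `β ^ 2`, scaled here by `π k ^ 2`.
  have hsub : ∀ k, HasSubgaussianMGF
      (fun h : ∀ k, H k => -(sgn γ * π k) * (u k (h k) - ∫ h, u k h ∂(μ k)))
      (p k ^ 2 * β ^ 2) (Measure.pi μ) := fun k => by
    have h1 := hasSubgaussianMGF_of_mem_Icc (μ := μ k) (a := -β) (b := β)
      (hu k).aemeasurable (ae_of_all _ fun h => abs_le.1 (hβ k h))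
    have h2 : (‖(β : ℝ) - -β‖₊ / 2) ^ 2 = β ^ 2 := by
      ext
      have h0 : (β : ℝ) - -β = 2 * β := by ring
      simp [h0]
    rw [h2, ← (measurePreserving_eval μ k).map_eq] at h1
    have h3 := (HasSubgaussianMGF.of_map (measurable_pi_apply k).aemeasurable h1).const_mul
      (-(sgn γ * π k))
    rw [(measurePreserving_eval μ k).map_eq] at h3
    have h4 : NNReal.mk ((-(sgn γ * π k)) ^ 2) (sq_nonneg _) = p k ^ 2 := by
      ext
      have := sgn_mul_self γ
      simp only [NNReal.coe_mk, NNReal.coe_pow, p, Real.coe_toNNReal _ (hπ k).le]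
      linear_combination π k ^ 2 * this
    rw [← h4]
    exact h3
  have hind : iIndepFun (fun k (h : ∀ k, H k) =>
      -(sgn γ * π k) * (u k (h k) - ∫ h, u k h ∂(μ k))) (Measure.pi μ) :=
    iIndepFun_pi (X := fun k h => -(sgn γ * π k) * (u k h - ∫ h, u k h ∂(μ k)))
      fun k => (((hu k).sub_const _).const_mul _).aemeasurable
  have h := HasSubgaussianMGF.measure_sum_ge_le_of_iIndepFun hind (s := Finset.univ)
    (fun k _ => hsub k) hδ
  refine (measureReal_mono fun x hx => ?_).trans (h.trans_eq ?_)
  · simp only [Set.mem_ofPred_eq] at hx ⊢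
    have e : ∑ k, -(sgn γ * π k) * (u k (x k) - ∫ h, u k h ∂(μ k)) =
        sgn γ * ∑ k, π k * (∫ h, u k h ∂(μ k) - c k) -
          sgn γ * ∑ k, π k * (u k (x k) - c k) := by
      rw [Finset.mul_sum, Finset.mul_sum, ← Finset.sum_sub_distrib]
      exact Finset.sum_congr rfl fun k _ => by ring
    rw [e]
    linarith
  · have e : ((∑ k, p k ^ 2 * β ^ 2 : ℝ≥0) : ℝ) = β ^ 2 * ∑ k, π k ^ 2 := by
      push_cast
      rw [Finset.mul_sum]
      exact Finset.sum_congr rfl fun k _ => by simp [p, (hπ k).le, mul_comm]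
    rw [e, neg_div, mul_assoc]

variable {N : ι → ℕ} {L : ∀ k, Bool → Measure (H k)} [∀ k γ, IsProbabilityMeasure (L k γ)]
  {T : ∀ k, (Fin (N k) → H k × Bool) → H k → ℝ}

omit [∀ k γ, IsProbabilityMeasure (L k γ)] in
lemma netMean_sub_netEmpMean (γ : Bool) (z : ∀ k, Fin (N k) → H k × Bool) (f : ∀ k, H k → ℝ) :
    netMean π L γ f - netEmpMean π z f =
      ∑ k, π k * (∫ h, f k h ∂(L k γ) - empMean (z k) (f k)) := by
  simp only [netMean, netEmpMean, mul_sub, Finset.sum_sub_distrib]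

lemma measurable_netMean (hT : ∀ k, Measurable (Function.uncurry (T k))) (γ : Bool) :
    Measurable fun z : ∀ k, Fin (N k) → H k × Bool => netMean π L γ fun k => T k (z k) := by
  refine Finset.measurable_sum _ fun k _ => Measurable.const_mul ?_ _
  exact (hT k).stronglyMeasurable.integral_prod_right.measurable.comp (measurable_pi_apply k)

omit [Fintype ι] in
lemma measurable_empMean (hT : ∀ k, Measurable (Function.uncurry (T k))) (k : ι) :
    Measurable fun z : Fin (N k) → H k × Bool => empMean z (T k z) := by
  refine Measurable.const_mul (Finset.measurable_sum _ fun i _ => ?_) _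
  exact (hT k).comp (measurable_id.prodMk (measurable_fst.comp (measurable_pi_apply i)))

lemma measurable_netEmpMean (hT : ∀ k, Measurable (Function.uncurry (T k))) :
    Measurable fun z : ∀ k, Fin (N k) → H k × Bool => netEmpMean π z fun k => T k (z k) :=
  Finset.measurable_sum _ fun k _ =>
    ((measurable_empMean hT k).comp (measurable_pi_apply k)).const_mul _

lemma measurable_ensemble (hT : ∀ k, Measurable (Function.uncurry (T k))) :
    Measurable fun p : (∀ k, Fin (N k) → H k × Bool) × (∀ k, H k) =>
      ensemble π T p.1 p.2 := by
  refine Finset.measurable_sum _ fun k _ => Measurable.const_mul (Measurable.sub ?_ ?_) _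
  · exact (hT k).comp (f := fun p : (∀ k, Fin (N k) → H k × Bool) × (∀ k, H k) => (p.1 k, p.2 k))
      (by fun_prop)
  · exact (measurable_empMean hT k).comp (by fun_prop)

lemma measurableSet_marginConsistent (hT : ∀ k, Measurable (Function.uncurry (T k))) (δ : ℝ) :
    MeasurableSet {z : ∀ k, Fin (N k) → H k × Bool | MarginConsistent π L δ T z} :=
  (measurableSet_lt ((measurable_netEmpMean hT).add_const δ) (measurable_netMean hT true)).inter
    (measurableSet_lt (measurable_netMean hT false) ((measurable_netEmpMean hT).sub_const δ))

variable {Ω : Type*} [MeasurableSpace Ω] {P : Measure Ω} [IsProbabilityMeasure P]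
  {Z : ∀ k, Fin (N k) → Ω → H k × Bool} {γs : Ω → Bool} {hs : ∀ k, Ω → H k}

/-- Independence allows conditioning on the training set. For a margin consistent one the Hoeffding
bound is the same for both labels, so it survives averaging over any prior; for the others the
section is empty. -/
lemma measure_misclassified_inter_le_of_bounded (hπ : ∀ k, 0 < π k) {β : ℝ} (hβ₀ : 0 ≤ β)
    (hβ : ∀ k z h, |T k z h| ≤ β) (hT : ∀ k, Measurable (Function.uncurry (T k)))
    (hZ : ∀ k n, Measurable (Z k n)) (hγs : Measurable γs) (hhs : ∀ k, Measurable (hs k))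
    (htest : ∀ (γ : Bool) (B : Set (∀ k, H k)), MeasurableSet B →
      P {ω | γs ω = γ ∧ (fun k => hs k ω) ∈ B} =
        P {ω | γs ω = γ} * Measure.pi (fun k => L k γ) B)
    (hindep : IndepFun (fun ω k n => Z k n ω) (fun ω => (γs ω, fun k => hs k ω)) P)
    {δ : ℝ} (hδ : 0 ≤ δ) :
    P {ω | MarginConsistent π L δ T (fun k n => Z k n ω) ∧
        sgn (γs ω) * ensemble π T (fun k n => Z k n ω) (fun k => hs k ω) ≤ 0} ≤
      ENNReal.ofReal (Real.exp (-(δ ^ 2 / (2 * β ^ 2 * ∑ k, π k ^ 2)))) *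
        P {ω | MarginConsistent π L δ T fun k n => Z k n ω} := by
  set e := ENNReal.ofReal (Real.exp (-(δ ^ 2 / (2 * β ^ 2 * ∑ k, π k ^ 2))))
  have hZm : Measurable fun ω k n => Z k n ω :=
    measurable_pi_iff.2 fun k => measurable_pi_iff.2 (hZ k)
  have hSm : Measurable fun ω => (γs ω, fun k => hs k ω) := hγs.prodMk (measurable_pi_iff.2 hhs)
  have hC := measurableSet_marginConsistent (π := π) (L := L) hT δ
  let D : Set ((∀ k, Fin (N k) → H k × Bool) × (Bool × ∀ k, H k)) :=
    {p | MarginConsistent π L δ T p.1 ∧ sgn p.2.1 * ensemble π T p.1 p.2.2 ≤ 0}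
  have hens : Measurable fun p : (∀ k, Fin (N k) → H k × Bool) × (Bool × ∀ k, H k) =>
      sgn p.2.1 * ensemble π T p.1 p.2.2 :=
    (measurable_sgn.comp (measurable_fst.comp measurable_snd)).mul
      ((measurable_ensemble hT).comp (f := fun p : (∀ k, Fin (N k) → H k × Bool) ×
        (Bool × ∀ k, H k) => (p.1, p.2.2)) (by fun_prop))
  have hD : MeasurableSet D :=
    (measurable_fst hC).inter (measurableSet_le hens measurable_const)
  have hmap := (indepFun_iff_map_prod_eq_prod_map_map hZm.aemeasurable hSm.aemeasurable).1 hindep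
  have hPD : P {ω | MarginConsistent π L δ T (fun k n => Z k n ω) ∧
      sgn (γs ω) * ensemble π T (fun k n => Z k n ω) (fun k => hs k ω) ≤ 0} =
      ∫⁻ z, P.map (fun ω => (γs ω, fun k => hs k ω)) (Prod.mk z ⁻¹' D)
        ∂(P.map fun ω k n => Z k n ω) := by
    rw [← Measure.prod_apply hD, ← hmap, Measure.map_apply (hZm.prodMk hSm) hD]
    rfl
  have hsec : ∀ z, P.map (fun ω => (γs ω, fun k => hs k ω)) (Prod.mk z ⁻¹' D) ≤
      {z | MarginConsistent π L δ T z}.indicator (fun _ => e) z := by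
    intro z
    by_cases hz : MarginConsistent π L δ T z
    · rw [Set.indicator_of_mem (by exact hz)]
      let B : Bool → Set (∀ k, H k) := fun γ => {h | sgn γ * ensemble π T z h ≤ 0}
      have hB : ∀ γ, MeasurableSet (B γ) := fun γ =>
        measurableSet_le (((measurable_ensemble hT).comp measurable_prodMk_left).const_mul _)
          measurable_const
      have hpi : ∀ γ, Measure.pi (fun k => L k γ) (B γ) ≤ e := fun γ => by
        -- The two inequalities of margin consistency say that the signed mean of the ensemble
        -- statistic exceeds `δ` under either label.
        have hm : δ ≤ sgn γ *
            ∑ k, π k * (∫ h, T k (z k) h ∂(L k γ) - empMean (z k) (T k (z k))) := by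
          rw [← netMean_sub_netEmpMean γ z fun k => T k (z k)]
          cases γ
          · simp only [sgn, Bool.false_eq_true, if_false]
            linarith [hz.2]
          · simp only [sgn, if_true]
            linarith [hz.1]
        rw [← ofReal_measureReal]
        exact ENNReal.ofReal_le_ofReal (measureReal_pi_ensemble_nonpos_le hπ
          (fun k => (hT k).comp measurable_prodMk_left) hβ₀ (fun k h => hβ k (z k) h) _ γ hδ hm)
      rw [Measure.map_apply hSm (measurable_prodMk_left hD)]
      calc P ((fun ω => (γs ω, fun k => hs k ω)) ⁻¹' (Prod.mk z ⁻¹' D))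
          ≤ P ({ω | γs ω = true ∧ (fun k => hs k ω) ∈ B true} ∪
              {ω | γs ω = false ∧ (fun k => hs k ω) ∈ B false}) := by
            refine measure_mono fun ω hω => ?_
            have h := hω.2
            cases hγ : γs ω
            · exact Or.inr ⟨hγ, by simpa [hγ, B] using h⟩
            · exact Or.inl ⟨hγ, by simpa [hγ, B] using h⟩
        _ ≤ P {ω | γs ω = true} * e + P {ω | γs ω = false} * e := by
            refine (measure_union_le _ _).trans (add_le_add ?_ ?_)
            · rw [htest _ _ (hB _)]
              exact mul_le_mul_right (hpi _) _
            · rw [htest _ _ (hB _)]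
              exact mul_le_mul_right (hpi _) _
        _ = e := by
            have h : {ω | γs ω = false} = {ω | γs ω = true}ᶜ := by
              ext ω
              simp
            rw [← add_mul, h, measure_add_measure_compl (s := {ω | γs ω = true})
              (hγs (measurableSet_singleton true)), measure_univ, one_mul]
    · have : Prod.mk z ⁻¹' D = ∅ := Set.eq_empty_of_forall_notMem fun x hx => hz hx.1
      rw [this, measure_empty]
      exact zero_le
  rw [hPD]
  refine (lintegral_mono hsec).trans_eq ?_
  rw [lintegral_indicator_const hC, Measure.map_apply hZm hC]
  rfl

/-- After margin consistent training the classification error is small. -/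
theorem measure_misclassified_inter_le (hπ : ∀ k, 0 < π k) {β : ℝ} (hβ₀ : 0 ≤ β)
    (hT : ∀ k, Measurable (Function.uncurry (T k)))
    (hβ : ∀ᵐ ω ∂P, ∀ k h, |T k (fun n => Z k n ω) h| ≤ β)
    (hZ : ∀ k n, Measurable (Z k n)) (hγs : Measurable γs) (hhs : ∀ k, Measurable (hs k))
    (htest : ∀ (γ : Bool) (B : Set (∀ k, H k)), MeasurableSet B →
      P {ω | γs ω = γ ∧ (fun k => hs k ω) ∈ B} =
        P {ω | γs ω = γ} * Measure.pi (fun k => L k γ) B)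
    (hindep : IndepFun (fun ω k n => Z k n ω) (fun ω => (γs ω, fun k => hs k ω)) P)
    {δ : ℝ} (hδ : 0 ≤ δ) :
    P {ω | MarginConsistent π L δ T (fun k n => Z k n ω) ∧
        sgn (γs ω) * ensemble π T (fun k n => Z k n ω) (fun k => hs k ω) ≤ 0} ≤
      ENNReal.ofReal (Real.exp (-(δ ^ 2 / (2 * β ^ 2 * ∑ k, π k ^ 2)))) *
        P {ω | MarginConsistent π L δ T fun k n => Z k n ω} := by
  -- The trained function is bounded by `β` only almost surely. Clipping makes the bound hold for
  -- every training set and alters the events only on a null set.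
  let T' : ∀ k, (Fin (N k) → H k × Bool) → H k → ℝ := fun k z h =>
    max (-β) (min β (T k z h))
  have h := measure_misclassified_inter_le_of_bounded (T := T') hπ hβ₀
    (fun k z h => abs_le.2 ⟨le_max_left _ _, max_le (by linarith) (min_le_left _ _)⟩)
    (fun k => measurable_const.max (measurable_const.min (hT k))) hZ hγs hhs htest hindep hδ
  have heq : ∀ᵐ ω ∂P, ∀ k, T' k (fun n => Z k n ω) = T k (fun n => Z k n ω) := by
    filter_upwards [hβ] with ω hω k
    funext x
    have := abs_le.1 (hω k x)
    simp only [T', min_eq_right this.2, max_eq_right this.1]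
  have hC : ∀ᵐ ω ∂P, (MarginConsistent π L δ T' (fun k n => Z k n ω) ↔
      MarginConsistent π L δ T (fun k n => Z k n ω)) := by
    filter_upwards [heq] with ω hω
    simp only [MarginConsistent, hω]
  have hE : ∀ᵐ ω ∂P, ensemble π T' (fun k n => Z k n ω) (fun k => hs k ω) =
      ensemble π T (fun k n => Z k n ω) (fun k => hs k ω) := by
    filter_upwards [heq] with ω hω
    simp only [ensemble, statistic, hω]
  have h1 : P {ω | MarginConsistent π L δ T' fun k n => Z k n ω} =
      P {ω | MarginConsistent π L δ T fun k n => Z k n ω} :=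
    measure_congr (eventuallyEq_set.2 hC)
  have h2 : P {ω | MarginConsistent π L δ T' (fun k n => Z k n ω) ∧
        sgn (γs ω) * ensemble π T' (fun k n => Z k n ω) (fun k => hs k ω) ≤ 0} =
      P {ω | MarginConsistent π L δ T (fun k n => Z k n ω) ∧
        sgn (γs ω) * ensemble π T (fun k n => Z k n ω) (fun k => hs k ω) ≤ 0} := by
    refine measure_congr (eventuallyEq_set.2 ?_)
    filter_upwards [hC, hE] with ω h1 h2
    simp only [h1, h2]
  rwa [h1, h2] at h

end Prediction

end SocialLearning
-- Assembly of the main theorem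
theorem theorem2
    {ι : Type*} [Fintype ι]
    {H : ι → Type*} [∀ k, MeasurableSpace (H k)]
    -- likelihood models of the agents
    (L : ∀ k, Bool → Measure (H k)) [∀ k γ, IsProbabilityMeasure (L k γ)]
    -- loss function
    (φ : ℝ → ℝ) (Lφ : ℝ≥0) (hφ : IsAdmissibleLoss φ Lφ)
    -- function classes
    (F : ∀ k, Set (H k → ℝ)) (hF : ∀ k, IsMeasurableClass (F k))
    (β : ℝ) (hβ : 0 < β) (hFβ : ∀ k, ∀ f ∈ F k, ∀ h, |f h| ≤ β)
    -- combination policy and its Perron eigenvector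
    (A : Matrix ι ι ℝ) (hA : IsStronglyConnectedPolicy A)
    (π : ι → ℝ) (hπ : IsPerronVector A π)
    -- training phase: each agent has i.i.d. training pairs and applies empirical risk minimization
    {Ω : Type*} [MeasurableSpace Ω] (P : Measure Ω) [IsProbabilityMeasure P]
    (N : ι → ℕ) (hN : ∀ k, 0 < N k)
    (Z : ∀ k, Fin (N k) → Ω → H k × Bool) (hZ : ∀ k n, Measurable (Z k n))
    (hZlaw : ∀ k n, P.map (Z k n) = trainLaw (L k))
    (hZind : ∀ k, iIndepFun (Z k) P)
    (T : ∀ k, (Fin (N k) → H k × Bool) → H k → ℝ)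
    (hT : ∀ k, Measurable (Function.uncurry (T k)))
    (hTmin : ∀ᵐ ω ∂P, ∀ k, MinimizesEmpRisk φ (F k) (T k) (fun n => Z k n ω))
    -- prediction phase: true label and testing samples, which are independent given the label, and
    -- jointly independent of the training phase
    (γs : Ω → Bool) (hγs : Measurable γs)
    (hs : ∀ k, Ω → H k) (hhs : ∀ k, Measurable (hs k))
    (htest : ∀ (γ : Bool) (B : Set (∀ k, H k)), MeasurableSet B →
      P {ω | γs ω = γ ∧ (fun k => hs k ω) ∈ B} =
        P {ω | γs ω = γ} * Measure.pi (fun k => L k γ) B)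
    (hindep : IndepFun (fun ω k n => Z k n ω) (fun ω => (γs ω, fun k => hs k ω)) P)
    -- the informative task, the margin and the complexity
    (hR : netTargetRisk π φ L F < φ 0)
    (δ : ℝ) (hδ : 0 ≤ δ) (hδmax : δ < deltaMax φ Lφ (netTargetRisk π φ L F))
    (hρ : netRademacher π L F N < difficulty φ Lφ (netTargetRisk π φ L F) δ) :
    -- event of `δ`-margin consistent training and event of misclassification
    let C : Set Ω := {ω | MarginConsistent π L δ T (fun k n => Z k n ω)}
    let cs : Ω → ℝ := fun ω => ensemble π T (fun k n => Z k n ω) (fun k => hs k ω)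
    let M : Set Ω := {ω | sgn (γs ω) * cs ω ≤ 0}
    -- the consensus rule leads all agents to the ensemble statistic
    (∀ ω k, Tendsto
      (fun t => consensus A (fun ℓ => statistic (T ℓ) (fun n => Z ℓ n ω) (hs ℓ ω)) t k)
      atTop (𝓝 (cs ω))) ∧
    (P[|C]).real M ≤ Real.exp (-(δ ^ 2 / (2 * β ^ 2 * ∑ k, π k ^ 2))) ∧
    P.real M ≤
      2 * Real.exp (-(8 * (Nmax N : ℝ) / (imbalance π N ^ 2 * β ^ 2) *
        (difficulty φ Lφ (netTargetRisk π φ L F) δ - netRademacher π L F N) ^ 2)) +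
      Real.exp (-(δ ^ 2 / (2 * β ^ 2 * ∑ k, π k ^ 2))) := by
  intro C cs M
  have hCm : MeasurableSet C := measurable_pi_iff.2 (fun k => measurable_pi_iff.2 (hZ k))
    (measurableSet_marginConsistent (π := π) (L := L) hT δ)
  have htestbound : P.real (C ∩ M) ≤
      Real.exp (-(δ ^ 2 / (2 * β ^ 2 * ∑ k, π k ^ 2))) * P.real C := by
    have h := measure_misclassified_inter_le hπ.pos hβ.le hT (hTmin.mono fun ω hω k =>
      hFβ k _ (hω k).1) hZ hγs hhs htest hindep hδ
    have h' := ENNReal.toReal_mono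
      (ENNReal.mul_ne_top ENNReal.ofReal_ne_top (measure_ne_top P _)) h
    rwa [ENNReal.toReal_mul, ENNReal.toReal_ofReal (Real.exp_pos _).le] at h'
  refine ⟨fun ω k => tendsto_consensus hA hπ _ k, ?_, ?_⟩
  · rw [measureReal_def, cond_apply hCm, ENNReal.toReal_mul, ENNReal.toReal_inv]
    change (P.real C)⁻¹ * P.real (C ∩ M) ≤ _
    -- If `C` is null, the conditional probability takes the default value `0`, since `0⁻¹ = 0`.
    rcases (measureReal_nonneg (μ := P) (s := C)).eq_or_lt with h0 | h0
    · rw [← h0, inv_zero, zero_mul]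
      exact (Real.exp_pos _).le
    · rwa [inv_mul_le_iff₀ h0, mul_comm]
  · have hsub : M ⊆ Cᶜ ∪ (C ∩ M) := fun ω hω => by
      by_cases h : ω ∈ C
      · exact Or.inr ⟨h, hω⟩
      · exact Or.inl h
    refine (measureReal_mono hsub).trans ((measureReal_union_le _ _).trans (add_le_add ?_ ?_))
    · exact measureReal_not_marginConsistent_le hπ.pos hπ.sum_eq_one hφ hβ hF hFβ hN hZ hZlaw
        hZind hTmin hρ
    · exact htestbound.trans (mul_le_of_le_one_right (Real.exp_pos _).le measureReal_le_one)
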